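/- Let $\mathcal{B}$ be an additive category and $N\ge 2$ an integer. An $N$-complex $X=(X^i,d_X^i)_{i\in\mathbb{Z}}$ in $\mathcal{B}$ consists of objects $X^i$ and morphisms $d_X^i\colon X^i\to X^{i+1}$ such that $d_X^{i+N-1}\cdots d_X^{i+1}d_X^i=0$ for all $i$; morphisms $f\colon X\to Y$ are families $f^i\colon X^i\to Y^i$ commuting with the $d^i$. A morphism $f\colon X\to Y$ is null-homotopic if there are $s^i\colon X^i\to Y^{i-N+1}$ $(i\in\mathbb{Z})$ with $$f^i=\sum_{j=1}^{N} d_Y^{i-1}\cdots d_Y^{i-N+j}\; s^{i+j-1}\; d_X^{i+j-2}\cdots d_X^{i}\qquad(i\in\mathbb{Z}).$$ The homotopy category $\mathsf{K}_N(\mathcal{B})$ has the $N$-complexes as objects and the morphisms modulo null-homotopic ones as morphisms. For $f\colon X\to Y$ the mapping cone $C(f)$ is the $N$-complex with $C(f)^m=Y^m\oplus X^{m+1}\oplus\cdots\oplus X^{m+N-1}$ and differential $$(y,x_1,\dots,x_{N-1})\mapsto\Bigl(d_Y y+f x_1,\;x_2,\;\dots,\;x_{N-1},\;-\sum_{k=1}^{N-1}d_X^{\{N-k\}}x_k\Bigr),$$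 where $d_X^{\{j\}}$ denotes a composite of $j$ consecutive differentials. The suspension $\Sigma X$ is the $N$-complex $(\Sigma X)^m=X^{m+1}\oplus\cdots\oplus X^{m+N-1}$ with differential $(x_1,\dots,x_{N-1})\mapsto(x_2,\dots,x_{N-1},-\sum_{k}d_X^{\{N-k\}}x_k)$. A triangle in $\mathsf{K}_N(\mathcal{B})$ is a sequence isomorphic in $\mathsf{K}_N(\mathcal{B})$ to $X\xrightarrow{f}Y\to C(f)\to\Sigma X$, with the canonical inclusion and projection, for some morphism $f$ of $N$-complexes. For $s\in\mathbb{Z}$ and $0\le r<N$ let $\mathcal{F}_s^r$ be the full subcategory of $\mathsf{K}_N(\mathcal{B})$ of all objects isomorphic in $\mathsf{K}_N(\mathcal{B})$ to an $N$-complex $X$ such that, for every $i\equiv s\pmod N$ and every $0\le k<r$, one has $X^{i+k}=X^{i+k+1}$ and $d_X^{i+k}=1_{X^{i+k}}$ (so $\mathcal{F}_s^0=\mathsf{K}_N(\mathcal{B})$). **Theorem.** For every $s\in\mathbb{Z}$ and $1\le r<N$, the pair $(\mathcal{U},\mathcal{V})=(\mathcal{F}_s^r,\mathcal{F}_{r+s+1}^{N-r-1})$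 is a stable $t$-structure in $\mathsf{K}_N(\mathcal{B})$; that is: (a) $\Sigma\,\mathcal{U}=\mathcal{U}$ and $\Sigma\,\mathcal{V}=\mathcal{V}$, where $\Sigma\,\mathcal{U}$ denotes the full subcategory of the objects isomorphic to $\Sigma U$ for some $U\in\mathcal{U}$; (b) $\operatorname{Hom}_{\mathsf{K}_N(\mathcal{B})}(U,V)=0$ for all $U\in\mathcal{U}$ and $V\in\mathcal{V}$; (c) for every object $X$ of $\mathsf{K}_N(\mathcal{B})$ there is a triangle $U\to X\to V\to\Sigma U$ with $U\in\mathcal{U}$ and $V\in\mathcal{V}$. -/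

import Mathlib

open CategoryTheory CategoryTheory.Limits

universe v u

/-- The composite `X i ⟶ X (i + 1) ⟶ ⋯ ⟶ X j` of `n` consecutive maps, where `j = i + n`;
it is the identity for `n = 0`. -/
def seqComp {B : Type u} [Category.{v} B] (X : ℤ → B) (d : ∀ i, X i ⟶ X (i + 1)) :
    ∀ (n : ℕ) (i j : ℤ), i + n = j → (X i ⟶ X j)
  | 0, i, j, h => eqToHom (congrArg X (by simpa using h))
  | n + 1, i, j, h => d i ≫ seqComp X d n (i + 1) j (by push_cast at h; omega)

/-- The composite `d (j - 1) ∘ ⋯ ∘ d i : X i ⟶ X j` if `i ≤ j` (the identity if `i = j`),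
and `0` if `j < i`. -/
def dComp {B : Type u} [Category.{v} B] [HasZeroMorphisms B] (X : ℤ → B)
    (d : ∀ i, X i ⟶ X (i + 1)) (i j : ℤ) : X i ⟶ X j :=
  if h : i ≤ j then seqComp X d (j - i).toNat i j (by omega) else 0

section dComp

variable {B : Type u} [Category.{v} B] [HasZeroMorphisms B] (X : ℤ → B)
  (d : ∀ i, X i ⟶ X (i + 1))

theorem seqComp_eq_dComp (n : ℕ) (i j : ℤ) (h : i + n = j) :
    seqComp X d n i j h = dComp X d i j := by
  obtain rfl : n = (j - i).toNat := by omega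
  rw [dComp, dif_pos (by omega)]

theorem dComp_self (i : ℤ) : dComp X d i i = 𝟙 (X i) := by
  rw [← seqComp_eq_dComp X d 0 i i (by simp)]
  simp [seqComp]

theorem dComp_of_lt {i j : ℤ} (h : i < j) : dComp X d i j = d i ≫ dComp X d (i + 1) j := by
  rw [← seqComp_eq_dComp X d (j - (i + 1)).toNat (i + 1) j (by omega),
    ← seqComp_eq_dComp X d ((j - (i + 1)).toNat + 1) i j (by push_cast; omega)]
  rfl

theorem dComp_succ (i : ℤ) : dComp X d i (i + 1) = d i := by
  rw [dComp_of_lt X d (by omega), dComp_self, Category.comp_id]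

theorem dComp_comp {i j k : ℤ} (h : i ≤ j) (h' : j ≤ k) :
    dComp X d i j ≫ dComp X d j k = dComp X d i k := by
  obtain ⟨n, rfl⟩ := Int.le.dest h
  induction n generalizing i with
  | zero =>
    have e : i + ((0 : ℕ) : ℤ) = i := by simp
    rw [e, dComp_self, Category.id_comp]
  | succ n ih =>
    have e : i + ((n + 1 : ℕ) : ℤ) = (i + 1) + n := by push_cast; ring
    rw [e] at h' ⊢
    rw [dComp_of_lt X d (by omega), Category.assoc, ih (by omega) h',
      ← dComp_of_lt X d (by omega)]

end dComp

/-- An `N`-complex in `B`: objects `X i` and differentials `d i : X i ⟶ X (i + 1)` such that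
every composite of `N` consecutive differentials vanishes. -/
structure NComplex (B : Type u) [Category.{v} B] [HasZeroMorphisms B] (N : ℕ) where
  X : ℤ → B
  d : ∀ i, X i ⟶ X (i + 1)
  dComp_eq_zero : ∀ i, dComp X d i (i + N) = 0

namespace NComplex

section Basic

variable {B : Type u} [Category.{v} B] [HasZeroMorphisms B] {N : ℕ}

/-- The composite of consecutive differentials `X i ⟶ X j` (the identity if `i = j`,
and `0` if `j < i`). -/
def dd (X : NComplex B N) (i j : ℤ) : X.X i ⟶ X.X j := dComp X.X X.d i j

/-- A morphism of `N`-complexes. -/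
@[ext]
structure Hom (X Y : NComplex B N) where
  f : ∀ i, X.X i ⟶ Y.X i
  comm : ∀ i, X.d i ≫ f (i + 1) = f i ≫ Y.d i

instance : Category (NComplex B N) where
  Hom X Y := Hom X Y
  id X := { f := fun i => 𝟙 (X.X i), comm := by simp }
  comp φ ψ :=
    { f := fun i => φ.f i ≫ ψ.f i
      comm := fun i => by rw [← Category.assoc, φ.comm, Category.assoc, ψ.comm, Category.assoc] }

@[ext]
theorem hom_ext {X Y : NComplex B N} {φ ψ : X ⟶ Y} (h : ∀ i, φ.f i = ψ.f i) : φ = ψ :=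
  Hom.ext (funext h)

@[simp]
theorem id_f (X : NComplex B N) (i : ℤ) : Hom.f (𝟙 X) i = 𝟙 (X.X i) := rfl

@[simp]
theorem comp_f {X Y Z : NComplex B N} (φ : X ⟶ Y) (ψ : Y ⟶ Z) (i : ℤ) :
    (φ ≫ ψ).f i = φ.f i ≫ ψ.f i := rfl

theorem dd_self (X : NComplex B N) (i : ℤ) : X.dd i i = 𝟙 (X.X i) := dComp_self X.X X.d i

theorem dd_succ (X : NComplex B N) (i : ℤ) : X.dd i (i + 1) = X.d i := dComp_succ X.X X.d i

theorem dd_comp (X : NComplex B N) {i j k : ℤ} (h : i ≤ j) (h' : j ≤ k) :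
    X.dd i j ≫ X.dd j k = X.dd i k := dComp_comp X.X X.d h h'

theorem dd_eq_zero (X : NComplex B N) {i j : ℤ} (h : i + N ≤ j) : X.dd i j = 0 := by
  rw [← X.dd_comp (show i ≤ i + N by omega) h]
  have := X.dComp_eq_zero i
  rw [show X.dd i (i + N) = 0 from this, zero_comp]

theorem dd_naturality {X Y : NComplex B N} (φ : X ⟶ Y) (i j : ℤ) :
    X.dd i j ≫ φ.f j = φ.f i ≫ Y.dd i j := by
  by_cases h : i ≤ j
  · obtain ⟨n, rfl⟩ := Int.le.dest h
    clear h
    induction n with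
    | zero =>
      obtain e : i + ((0 : ℕ) : ℤ) = i := by simp
      rw [e, dd_self, dd_self, Category.id_comp, Category.comp_id]
    | succ n ih =>
      have e : i + ((n + 1 : ℕ) : ℤ) = (i + n) + 1 := by push_cast; ring
      rw [e, ← X.dd_comp (show i ≤ i + n by omega) (by omega),
        ← Y.dd_comp (show i ≤ i + n by omega) (by omega), X.dd_succ, Y.dd_succ, Category.assoc,
        φ.comm, ← Category.assoc, ih, Category.assoc]
  · simp [dd, dComp, h]

end Basic

section Preadd

variable {B : Type u} [Category.{v} B] [Preadditive B] {N : ℕ}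

instance (X Y : NComplex B N) : Zero (X ⟶ Y) := ⟨{ f := fun _ => 0, comm := by simp }⟩

instance (X Y : NComplex B N) : Add (X ⟶ Y) :=
  ⟨fun φ ψ => { f := fun i => φ.f i + ψ.f i, comm := by simp [φ.comm, ψ.comm] }⟩

instance (X Y : NComplex B N) : Neg (X ⟶ Y) :=
  ⟨fun φ => { f := fun i => -φ.f i, comm := by simp [φ.comm] }⟩

instance (X Y : NComplex B N) : Sub (X ⟶ Y) :=
  ⟨fun φ ψ => { f := fun i => φ.f i - ψ.f i, comm := by simp [φ.comm, ψ.comm] }⟩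

instance (X Y : NComplex B N) : SMul ℕ (X ⟶ Y) :=
  ⟨fun n φ => { f := fun i => n • φ.f i, comm := by simp [φ.comm] }⟩

instance (X Y : NComplex B N) : SMul ℤ (X ⟶ Y) :=
  ⟨fun n φ => { f := fun i => n • φ.f i, comm := by simp [φ.comm] }⟩

instance (X Y : NComplex B N) : AddCommGroup (X ⟶ Y) :=
  Function.Injective.addCommGroup Hom.f (fun _ _ h => Hom.ext h) rfl (fun _ _ => rfl)
    (fun _ => rfl) (fun _ _ => rfl) (fun _ _ => rfl) (fun _ _ => rfl)

@[simp]
theorem zero_f (X Y : NComplex B N) (i : ℤ) : (0 : X ⟶ Y).f i = 0 := rfl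

@[simp]
theorem add_f {X Y : NComplex B N} (φ ψ : X ⟶ Y) (i : ℤ) : (φ + ψ).f i = φ.f i + ψ.f i := rfl

@[simp]
theorem sub_f {X Y : NComplex B N} (φ ψ : X ⟶ Y) (i : ℤ) : (φ - ψ).f i = φ.f i - ψ.f i := rfl

instance : Preadditive (NComplex B N) where
  homGroup _ _ := inferInstance
  add_comp _ _ _ _ _ _ := by ext; simp
  comp_add _ _ _ _ _ _ := by ext; simp

/-- The `N`-complexes `X` such that the `r` consecutive differentials `d i, …, d (i + r - 1)` are
identity morphisms (in particular `X i = ⋯ = X (i + r)`) for every `i ≡ s` modulo `N`. -/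
def HasIdentities (s : ℤ) (r : ℕ) : ObjectProperty (NComplex B N) := fun X =>
  ∀ i : ℤ, i ≡ s [ZMOD N] → ∀ k : ℕ, k < r →
    ∃ h : X.X (i + k) = X.X (i + k + 1), X.d (i + k) = eqToHom h

/-- A morphism `φ` is null-homotopic if there are `s i : X i ⟶ Y (i - N + 1)` such that
`φ i` is the sum over `j = 0, …, N - 1` of the composites
`X i ⟶ X (i + j) ⟶ Y (i + j - N + 1) ⟶ Y i`, whose outer maps are `j` resp. `N - 1 - j`
consecutive differentials. -/
def NullHomotopic {X Y : NComplex B N} (φ : X ⟶ Y) : Prop :=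
  ∃ s : ∀ i : ℤ, X.X i ⟶ Y.X (i - N + 1), ∀ i : ℤ,
    φ.f i = ∑ j ∈ Finset.range N, X.dd i (i + j) ≫ s (i + j) ≫ Y.dd (i + j - N + 1) i

theorem NullHomotopic.zero (X Y : NComplex B N) : NullHomotopic (0 : X ⟶ Y) :=
  ⟨fun _ => 0, fun i => by simp⟩

theorem NullHomotopic.add {X Y : NComplex B N} {φ ψ : X ⟶ Y} (h : NullHomotopic φ)
    (h' : NullHomotopic ψ) : NullHomotopic (φ + ψ) := by
  obtain ⟨s, hs⟩ := h
  obtain ⟨t, ht⟩ := h'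
  exact ⟨fun i => s i + t i, fun i => by simp [hs, ht, Finset.sum_add_distrib]⟩

theorem NullHomotopic.neg {X Y : NComplex B N} {φ : X ⟶ Y} (h : NullHomotopic φ) :
    NullHomotopic (-φ) := by
  obtain ⟨s, hs⟩ := h
  refine ⟨fun i => -s i, fun i => ?_⟩
  change -φ.f i = _
  simp [hs]

theorem NullHomotopic.comp_left {X Y Z : NComplex B N} (ψ : X ⟶ Y) {φ : Y ⟶ Z}
    (h : NullHomotopic φ) : NullHomotopic (ψ ≫ φ) := by
  obtain ⟨s, hs⟩ := h
  refine ⟨fun i => ψ.f i ≫ s i, fun i => ?_⟩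
  rw [comp_f, hs, Preadditive.comp_sum]
  refine Finset.sum_congr rfl fun j _ => ?_
  rw [← Category.assoc, ← dd_naturality]
  simp

theorem NullHomotopic.comp_right {X Y Z : NComplex B N} {φ : X ⟶ Y} (ψ : Y ⟶ Z)
    (h : NullHomotopic φ) : NullHomotopic (φ ≫ ψ) := by
  obtain ⟨s, hs⟩ := h
  refine ⟨fun i => s i ≫ ψ.f (i - N + 1), fun i => ?_⟩
  rw [comp_f, hs, Preadditive.sum_comp]
  refine Finset.sum_congr rfl fun j _ => ?_
  simp [dd_naturality]

end Preadd

variable (B : Type u) [Category.{v} B] [Preadditive B] (N : ℕ)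

/-- Two morphisms of `N`-complexes are homotopic if their difference is null-homotopic. -/
def homotopic : HomRel (NComplex B N) := fun _ _ φ ψ => NullHomotopic (φ - ψ)

instance homotopic_congruence : Congruence (homotopic B N) where
  equivalence :=
    { refl := fun φ => by
        change NullHomotopic (φ - φ)
        rw [sub_self]; exact .zero _ _
      symm := fun {φ ψ} h => by
        change NullHomotopic (ψ - φ)
        rw [← neg_sub]; exact h.neg
      trans := fun {φ ψ χ} h h' => by
        change NullHomotopic (φ - χ)
        rw [← sub_add_sub_cancel φ ψ χ]; exact h.add h' }
  comp_left := fun χ φ ψ h => by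
    change NullHomotopic (χ ≫ φ - χ ≫ ψ)
    rw [← Preadditive.comp_sub]; exact NullHomotopic.comp_left χ h
  comp_right := fun {_ _ _ φ ψ} χ h => by
    change NullHomotopic (φ ≫ χ - ψ ≫ χ)
    rw [← Preadditive.sub_comp]; exact NullHomotopic.comp_right χ h

end NComplex

/-- The homotopy category `K_N(B)` of `N`-complexes in `B`. -/
def KN (B : Type u) [Category.{v} B] [Preadditive B] (N : ℕ) :=
  Quotient (NComplex.homotopic B N)

namespace KN

variable (B : Type u) [Category.{v} B] [Preadditive B] (N : ℕ)

instance : Category (KN B N) := inferInstanceAs (Category (Quotient (NComplex.homotopic B N)))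

instance : Preadditive (KN B N) :=
  Quotient.preadditive (NComplex.homotopic B N) (by
    intro X Y φ₁ φ₂ ψ₁ ψ₂ h h'
    change NComplex.NullHomotopic (φ₁ + ψ₁ - (φ₂ + ψ₂))
    rw [add_sub_add_comm]; exact h.add h')

/-- The quotient functor from `N`-complexes to `K_N(B)`. -/
def quotient : NComplex B N ⥤ KN B N := Quotient.functor (NComplex.homotopic B N)

end KN

namespace NComplex

attribute [local instance] hasBinaryBiproducts_of_finite_biproducts

variable {B : Type u} [Category.{v} B] [Preadditive B] [HasFiniteBiproducts B] {N : ℕ}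

section Shift

variable (X : NComplex B N)

/-- The object `X (m + 1) ⊕ ⋯ ⊕ X (m + N - 1)`; the summand with index `k` is `X (m + 1 + k)`. -/
noncomputable abbrev shiftX (m : ℤ) : B := ⨁ fun k : Fin (N - 1) => X.X (m + 1 + (k : ℕ))

/-- The projection of `X (m + 1) ⊕ ⋯ ⊕ X (m + N - 1)` onto `X (m + 1 + k)`
(zero if `k` is not one of `0, …, N - 2`). -/
noncomputable def shiftProj (m : ℤ) (k : ℕ) : X.shiftX m ⟶ X.X (m + 1 + k) :=
  if h : k < N - 1 then biproduct.π (fun k : Fin (N - 1) => X.X (m + 1 + (k : ℕ))) ⟨k, h⟩ else 0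

/-- The morphism into `X (m + 1) ⊕ ⋯ ⊕ X (m + N - 1)` with given components. -/
noncomputable def shiftLift {T : B} (m : ℤ) (g : ∀ k : ℕ, T ⟶ X.X (m + 1 + k)) :
    T ⟶ X.shiftX m :=
  biproduct.lift fun k : Fin (N - 1) => g k

/-- The differential of the suspension. It maps `(x₁, …, x_{N-1})`, with `x_k` in `X (m + k)`, to
`(x₂, …, x_{N-1}, - ∑ k, d^{N-k} x_k)`. -/
noncomputable def shiftD (m : ℤ) : X.shiftX m ⟶ X.shiftX (m + 1) :=
  X.shiftLift (m + 1) fun l =>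
    if l + 1 < N - 1 then
      X.shiftProj m (l + 1) ≫ X.dd (m + 1 + (l + 1 : ℕ)) (m + 1 + 1 + l)
    else
      -∑ k ∈ Finset.range (N - 1), X.shiftProj m k ≫ X.dd (m + 1 + k) (m + 1 + 1 + l)

theorem shiftLift_proj {T : B} (m : ℤ) (g : ∀ k : ℕ, T ⟶ X.X (m + 1 + k)) {k : ℕ}
    (h : k < N - 1) : X.shiftLift m g ≫ X.shiftProj m k = g k := by
  rw [shiftProj, dif_pos h]
  exact biproduct.lift_π _ _

theorem shift_ext {T : B} {m : ℤ} {g g' : T ⟶ X.shiftX m}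
    (h : ∀ k : ℕ, k < N - 1 → g ≫ X.shiftProj m k = g' ≫ X.shiftProj m k) : g = g' := by
  refine biproduct.hom_ext _ _ fun k => ?_
  have := h k k.2
  rw [shiftProj, dif_pos k.2] at this
  exact this

/-- Auxiliary: the `k`-th term of the sequence `(x₁, x₂, …, x_{N-1}, x_N, 0, 0, …)` with
`x_N = - ∑ k, d^{N-k} x_k`, pushed forward to `X j`. -/
noncomputable def shiftSeq (m : ℤ) (k : ℕ) (j : ℤ) : X.shiftX m ⟶ X.X j :=
  if k < N - 1 then X.shiftProj m k ≫ X.dd (m + 1 + k) j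
  else if k = N - 1 then -∑ l ∈ Finset.range (N - 1), X.shiftProj m l ≫ X.dd (m + 1 + l) j
  else 0

theorem shiftSeq_eq_proj (m : ℤ) (k : ℕ) (h : k < N - 1) :
    X.shiftSeq m k (m + 1 + k) = X.shiftProj m k := by
  rw [shiftSeq, if_pos h, dd_self, Category.comp_id]

theorem shiftSeq_dd (m : ℤ) (k : ℕ) {j j' : ℤ} (h : m + 1 + k ≤ j) (h' : j ≤ j') :
    X.shiftSeq m k j ≫ X.dd j j' = X.shiftSeq m k j' := by
  unfold shiftSeq
  split_ifs with h1 h2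
  · rw [Category.assoc, dd_comp _ h h']
  · rw [Preadditive.neg_comp, Preadditive.sum_comp]
    congr 1
    refine Finset.sum_congr rfl fun l hl => ?_
    rw [Finset.mem_range] at hl
    rw [Category.assoc, dd_comp _ (by omega) h']
  · simp

theorem shiftSeq_sum (m : ℤ) (j : ℤ) : ∑ k ∈ Finset.range N, X.shiftSeq m k j = 0 := by
  rcases N with _ | n
  · simp
  · rw [Finset.sum_range_succ]
    have : ∀ k ∈ Finset.range n, X.shiftSeq m k j = X.shiftProj m k ≫ X.dd (m + 1 + k) j := by
      intro k hk
      rw [Finset.mem_range] at hk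
      rw [shiftSeq, if_pos (by omega)]
    rw [Finset.sum_congr rfl this, shiftSeq, if_neg (by omega), if_pos (by omega)]
    simp

theorem shiftD_seq (m : ℤ) (k : ℕ) {j : ℤ} (h : m + 1 + 1 + k ≤ j) :
    X.shiftD m ≫ X.shiftSeq (m + 1) k j = X.shiftSeq m (k + 1) j := by
  have step : ∀ k : ℕ, k < N - 1 → ∀ j, m + 1 + 1 + k ≤ j →
      X.shiftD m ≫ X.shiftSeq (m + 1) k j = X.shiftSeq m (k + 1) j := by
    intro k hk j h
    rw [shiftSeq, if_pos hk, shiftD, ← Category.assoc, shiftLift_proj _ _ _ hk]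
    split_ifs with h1
    · rw [shiftSeq, if_pos h1, Category.assoc, dd_comp _ (by push_cast; omega) h]
    · rw [shiftSeq, if_neg h1, if_pos (by omega), Preadditive.neg_comp, Preadditive.sum_comp]
      congr 1
      refine Finset.sum_congr rfl fun l hl => ?_
      rw [Finset.mem_range] at hl
      rw [Category.assoc, dd_comp _ (by omega) h]
  by_cases hk : k < N - 1
  · exact step k hk j h
  · rw [show X.shiftSeq m (k + 1) j = 0 by rw [shiftSeq, if_neg (by omega), if_neg (by omega)]]
    by_cases hk' : k = N - 1
    · have e : X.shiftSeq (m + 1) k j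
          = -∑ l ∈ Finset.range (N - 1), X.shiftSeq (m + 1) l j := by
        rw [shiftSeq, if_neg hk, if_pos hk']
        congr 1
        refine Finset.sum_congr rfl fun l hl => ?_
        rw [Finset.mem_range] at hl
        rw [shiftSeq, if_pos hl]
      rw [e, Preadditive.comp_neg, Preadditive.comp_sum, neg_eq_zero]
      rcases N with _ | n
      · simp
      · have e2 := X.shiftSeq_sum m j
        rw [Finset.sum_range_succ'] at e2
        have e3 : X.shiftSeq m 0 j = 0 := by
          rw [shiftSeq]
          split_ifs with h1 h2
          · rw [X.dd_eq_zero (by push_cast; omega), comp_zero]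
          · rw [← h2]; simp
          · rfl
        rw [e3, add_zero] at e2
        rw [← e2]
        refine Finset.sum_congr rfl fun l hl => ?_
        rw [Finset.mem_range] at hl
        exact step l hl j (by omega)
    · rw [shiftSeq, if_neg hk, if_neg hk', comp_zero]

theorem shiftD_iter_seq (m : ℤ) (n k : ℕ) {j : ℤ} (h : m + n + 1 + k ≤ j) :
    dComp X.shiftX X.shiftD m (m + n) ≫ X.shiftSeq (m + n) k j = X.shiftSeq m (n + k) j := by
  induction n generalizing k with
  | zero =>
    have e : m + ((0 : ℕ) : ℤ) = m := by simp
    rw [e, dComp_self, Category.id_comp, Nat.zero_add]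
  | succ n ih =>
    have e : m + ((n + 1 : ℕ) : ℤ) = (m + n) + 1 := by push_cast; ring
    rw [e] at h ⊢
    rw [← dComp_comp _ _ (show m ≤ m + n by omega) (show m + n ≤ m + n + 1 by omega), dComp_succ,
      Category.assoc, shiftD_seq _ _ _ h, ih _ (by push_cast; omega)]
    congr 1
    omega

/-- The suspension `ΣX` of an `N`-complex `X`. -/
noncomputable abbrev shift : NComplex B N where
  X := X.shiftX
  d := X.shiftD
  dComp_eq_zero m := by
    refine X.shift_ext fun k hk => ?_
    rw [zero_comp, ← shiftSeq_eq_proj _ _ _ hk, shiftD_iter_seq _ _ _ _ le_rfl, shiftSeq,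
      if_neg (by omega), if_neg (by omega)]

theorem shift_dd_seq {m m' : ℤ} (hm : m ≤ m') (k k' : ℕ) (hk : m' + k = m + k') {j : ℤ}
    (h : m' + 1 + k ≤ j) :
    X.shift.dd m m' ≫ X.shiftSeq m' k j = X.shiftSeq m k' j := by
  obtain ⟨n, rfl⟩ := Int.le.dest hm
  obtain rfl : k' = n + k := by omega
  exact X.shiftD_iter_seq m n k h

end Shift

section ShiftMap

variable {X Y Z : NComplex B N}

/-- The diagonal map `X (m + 1) ⊕ ⋯ ⊕ X (m + N - 1) ⟶ Y (m + 1) ⊕ ⋯ ⊕ Y (m + N - 1)`. -/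
noncomputable def shiftMapF (φ : X ⟶ Y) (m : ℤ) : X.shiftX m ⟶ Y.shiftX m :=
  Y.shiftLift m fun k => X.shiftProj m k ≫ φ.f (m + 1 + k)

theorem shiftMapF_seq (φ : X ⟶ Y) (m : ℤ) (k : ℕ) (j : ℤ) :
    shiftMapF φ m ≫ Y.shiftSeq m k j = X.shiftSeq m k j ≫ φ.f j := by
  have step : ∀ k : ℕ, k < N - 1 →
      shiftMapF φ m ≫ Y.shiftProj m k ≫ Y.dd (m + 1 + k) j
        = (X.shiftProj m k ≫ X.dd (m + 1 + k) j) ≫ φ.f j := by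
    intro k hk
    rw [shiftMapF, ← Category.assoc, shiftLift_proj _ _ _ hk, Category.assoc, Category.assoc,
      dd_naturality]
  unfold shiftSeq
  split_ifs with h1 h2
  · exact step k h1
  · rw [Preadditive.comp_neg, Preadditive.neg_comp, Preadditive.comp_sum, Preadditive.sum_comp]
    congr 1
    refine Finset.sum_congr rfl fun l hl => ?_
    rw [Finset.mem_range] at hl
    exact step l hl
  · simp

theorem shiftMapF_proj (φ : X ⟶ Y) (m : ℤ) (k : ℕ) :
    shiftMapF φ m ≫ Y.shiftProj m k = X.shiftProj m k ≫ φ.f (m + 1 + k) := by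
  by_cases h : k < N - 1
  · rw [shiftMapF, shiftLift_proj _ _ _ h]
  · simp [shiftProj, h]

/-- The suspension `Σφ : ΣX ⟶ ΣY` of a morphism `φ : X ⟶ Y`. -/
noncomputable def shiftMap (φ : X ⟶ Y) : X.shift ⟶ Y.shift where
  f := shiftMapF φ
  comm m := by
    refine Y.shift_ext fun k hk => ?_
    change (X.shiftD m ≫ shiftMapF φ (m + 1)) ≫ _ = (shiftMapF φ m ≫ Y.shiftD m) ≫ _
    rw [← shiftSeq_eq_proj _ _ _ hk, Category.assoc, Category.assoc, shiftMapF_seq,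
      shiftD_seq _ _ _ le_rfl, shiftMapF_seq, ← Category.assoc, shiftD_seq _ _ _ le_rfl]

variable (B N) in
/-- The suspension functor on `N`-complexes. -/
noncomputable def shiftFunctor : NComplex B N ⥤ NComplex B N where
  obj X := X.shift
  map φ := shiftMap φ
  map_id X := by
    refine hom_ext fun m => ?_
    refine X.shift_ext fun k hk => ?_
    change shiftMapF (𝟙 X) m ≫ _ = 𝟙 (X.shiftX m) ≫ _
    rw [shiftMapF_proj]
    simp
  map_comp {X Y Z} φ ψ := by
    refine hom_ext fun m => ?_
    refine Z.shift_ext fun k hk => ?_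
    change shiftMapF (φ ≫ ψ) m ≫ _ = (shiftMapF φ m ≫ shiftMapF ψ m) ≫ _
    rw [shiftMapF_proj, Category.assoc, shiftMapF_proj, ← Category.assoc, shiftMapF_proj]
    simp

theorem shiftMap_sub (φ ψ : X ⟶ Y) : shiftMap (φ - ψ) = shiftMap φ - shiftMap ψ := by
  refine hom_ext fun m => ?_
  refine Y.shift_ext fun k hk => ?_
  change shiftMapF (φ - ψ) m ≫ _ = (shiftMapF φ m - shiftMapF ψ m) ≫ _
  rw [Preadditive.sub_comp, shiftMapF_proj, shiftMapF_proj, shiftMapF_proj, sub_f,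
    Preadditive.comp_sub]

section Homotopy

variable (s : ∀ i : ℤ, X.X i ⟶ Y.X (i - N + 1))

/-- Auxiliary: the terms of the null-homotopy of the suspension of a null-homotopic map. -/
noncomputable def shiftT (m : ℤ) (i : ℕ) (a c : ℤ) : X.shiftX m ⟶ Y.X c :=
  X.shiftSeq m i a ≫ s a ≫ Y.dd (a - N + 1) c

/-- Auxiliary: the last component of the null-homotopy of the suspension of a null-homotopic
map. -/
noncomputable def shiftG (m c : ℤ) : X.shiftX m ⟶ Y.X c :=
  -∑ j ∈ Finset.range N, ∑ i ∈ Finset.range j, shiftT s m i (m + j) c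

theorem shiftG_dd {m c c' : ℤ} (h : m ≤ c) (h' : c ≤ c') :
    shiftG s m c ≫ Y.dd c c' = shiftG s m c' := by
  rw [shiftG, shiftG, Preadditive.neg_comp, Preadditive.sum_comp]
  congr 1
  refine Finset.sum_congr rfl fun j hj => ?_
  rw [Finset.mem_range] at hj
  rw [Preadditive.sum_comp]
  refine Finset.sum_congr rfl fun i _ => ?_
  rw [shiftT, shiftT, Category.assoc, Category.assoc, dd_comp _ (by omega) h']

theorem shiftD_G (m c : ℤ) :
    X.shiftD m ≫ shiftG s (m + 1) c
      = shiftG s m c + ∑ j ∈ Finset.range N, shiftT s m 0 (m + 1 + j) c := by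
  have cong : ∀ (i : ℕ) {a a' : ℤ}, a = a' → shiftT s m i a c = shiftT s m i a' c := by
    rintro i a _ rfl; rfl
  have e1 : X.shiftD m ≫ shiftG s (m + 1) c = -∑ j ∈ Finset.range N,
      (∑ i ∈ Finset.range (j + 1), shiftT s m i (m + (j + 1 : ℕ)) c
        - shiftT s m 0 (m + 1 + j) c) := by
    rw [shiftG, Preadditive.comp_neg, Preadditive.comp_sum]
    congr 1
    refine Finset.sum_congr rfl fun j hj => ?_
    rw [Preadditive.comp_sum, Finset.sum_range_succ', cong 0 (show m + ((j + 1 : ℕ) : ℤ)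
      = m + 1 + j by push_cast; ring), add_sub_cancel_right]
    refine Finset.sum_congr rfl fun i hi => ?_
    rw [Finset.mem_range] at hi
    rw [cong (i + 1) (show m + ((j + 1 : ℕ) : ℤ) = m + 1 + j by push_cast; ring), shiftT, shiftT,
      ← Category.assoc, shiftD_seq _ _ _ (by omega)]
  have e2 := Finset.sum_range_succ (fun j : ℕ =>
    ∑ i ∈ Finset.range j, shiftT s m i (m + j) c) N
  rw [Finset.sum_range_succ'] at e2
  have e3 : ∑ i ∈ Finset.range N, shiftT s m i (m + N) c = 0 := by
    simp only [shiftT]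
    rw [← Preadditive.sum_comp, shiftSeq_sum, zero_comp]
  rw [e3, Finset.sum_range_zero, add_zero, add_zero] at e2
  rw [e1, Finset.sum_sub_distrib, e2, shiftG]
  abel

/-- Auxiliary: the null-homotopy of the suspension of a null-homotopic map. -/
noncomputable def shiftS (m : ℤ) : X.shiftX m ⟶ Y.shiftX (m - N + 1) :=
  Y.shiftLift (m - N + 1) fun l => if l + 1 = N - 1 then shiftG s m (m - N + 1 + 1 + l) else 0

theorem shiftS_seq (m : ℤ) (k : ℕ) (c : ℤ) (h : m - N + 1 + 1 + k ≤ c) :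
    shiftS s m ≫ Y.shiftSeq (m - N + 1) k c =
      if k + 1 = N - 1 then shiftG s m c
      else if k = N - 1 ∧ k ≠ 0 then -shiftG s m c else 0 := by
  have step : ∀ k : ℕ, k < N - 1 → m - N + 1 + 1 + k ≤ c →
      shiftS s m ≫ Y.shiftProj (m - N + 1) k ≫ Y.dd (m - N + 1 + 1 + k) c =
        if k + 1 = N - 1 then shiftG s m c else 0 := by
    intro k hk h
    rw [shiftS, ← Category.assoc, shiftLift_proj _ _ _ hk]
    split_ifs with h1
    · rw [shiftG_dd _ (by omega) h]
    · rw [zero_comp]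
  rw [shiftSeq]
  by_cases h1 : k < N - 1
  · rw [if_pos h1, step k h1 h]
    split_ifs with h2 h3
    · rfl
    · omega
    · rfl
  · rw [if_neg h1, if_neg (show ¬ (k + 1 = N - 1) by omega)]
    by_cases h2 : k = N - 1
    · rw [if_pos h2, Preadditive.comp_neg, Preadditive.comp_sum]
      have : ∀ l ∈ Finset.range (N - 1), shiftS s m ≫ Y.shiftProj (m - N + 1) l ≫
          Y.dd (m - N + 1 + 1 + l) c = if l + 1 = N - 1 then shiftG s m c else 0 := by
        intro l hl
        rw [Finset.mem_range] at hl
        exact step l hl (by omega)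
      rw [Finset.sum_congr rfl this]
      by_cases h3 : k = 0
      · rw [if_neg (by omega), ← h2, h3]; simp
      · rw [if_pos ⟨h2, h3⟩, Finset.sum_eq_single_of_mem (N - 2)
          (Finset.mem_range.2 (by omega)), if_pos (by omega)]
        intro l _ hl
        rw [if_neg (by omega)]
    · rw [if_neg h2, if_neg (by tauto), comp_zero]

theorem shiftMap_nullHomotopic {φ : X ⟶ Y} (h : NullHomotopic φ) :
    NullHomotopic (shiftMap φ) := by
  obtain ⟨s, hs⟩ := h
  refine ⟨shiftS s, fun m => Y.shift_ext fun l hl => ?_⟩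
  have cong : ∀ {a a' : ℤ} (c : ℤ), a = a' →
      X.shift.dd m a ≫ shiftG s a c = X.shift.dd m a' ≫ shiftG s a' c := by
    rintro a _ c rfl; rfl
  set c : ℤ := m + 1 + l with hc
  have hterm : ∀ j ∈ Finset.range N,
      (X.shift.dd m (m + j) ≫ shiftS s (m + j) ≫ Y.shift.dd (m + j - N + 1) m)
        ≫ Y.shiftSeq m l c
      = (if j = l + 1 then X.shift.dd m (m + j) ≫ shiftG s (m + j) c else 0)
        - (if j = l then X.shift.dd m (m + j) ≫ shiftG s (m + j) c else 0) := by
    intro j hj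
    rw [Finset.mem_range] at hj
    rw [Category.assoc, Category.assoc, shift_dd_seq _ (by omega) l (l + (N - 1) - j) (by omega)
      (by omega), shiftS_seq _ _ _ _ (by omega)]
    by_cases h1 : j = l + 1
    · rw [if_pos (by omega), if_pos h1, if_neg (by omega), sub_zero]
    · rw [if_neg (by omega), if_neg h1]
      by_cases h2 : j = l
      · rw [if_pos (by omega), if_pos h2, Preadditive.comp_neg, zero_sub]
      · rw [if_neg (by omega), if_neg h2, comp_zero, sub_zero]
  have hf : ∀ a c : ℤ, c = a + 1 → ∑ j ∈ Finset.range N, shiftT s a 0 (a + 1 + j) c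
      = X.shiftSeq a 0 c ≫ φ.f c := by
    rintro a _ rfl
    rw [hs, Preadditive.comp_sum]
    refine Finset.sum_congr rfl fun j _ => ?_
    rw [shiftT, ← Category.assoc (X.shiftSeq a 0 (a + 1)),
      shiftSeq_dd _ _ _ (by push_cast; omega) (by omega)]
  change shiftMapF φ m ≫ _ = (∑ j ∈ Finset.range N,
    X.shift.dd m (m + j) ≫ shiftS s (m + j) ≫ Y.shift.dd (m + j - N + 1) m) ≫ _
  rw [← shiftSeq_eq_proj _ _ _ hl, shiftMapF_seq, Preadditive.sum_comp,
    Finset.sum_congr rfl hterm, Finset.sum_sub_distrib, Finset.sum_ite_eq', Finset.sum_ite_eq',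
    if_pos (Finset.mem_range.2 (by omega)), if_pos (Finset.mem_range.2 (by omega)),
    cong c (show m + ((l + 1 : ℕ) : ℤ) = m + l + 1 by push_cast; ring),
    ← X.shift.dd_comp (show m ≤ m + l by omega) (show m + (l : ℤ) ≤ m + l + 1 by omega),
    dd_succ, Category.assoc]
  change _ = X.shift.dd m (m + l) ≫ X.shiftD (m + l) ≫ shiftG s (m + l + 1) c - _
  rw [← Preadditive.comp_sub, shiftD_G, add_sub_cancel_left]
  rw [hf _ _ (by omega), ← Category.assoc, shift_dd_seq _ (by omega) 0 l (by push_cast; omega)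
    (by push_cast; omega)]

end Homotopy

end ShiftMap

section Cone

variable {X Y : NComplex B N} (φ : X ⟶ Y)

/-- The object `Y m ⊕ (X (m + 1) ⊕ ⋯ ⊕ X (m + N - 1))` of the mapping cone of `φ : X ⟶ Y`. -/
noncomputable abbrev coneX (_ : X ⟶ Y) (m : ℤ) : B := Y.X m ⊞ X.shiftX m

/-- The differential of the mapping cone of `φ : X ⟶ Y`. It maps `(y, x₁, …, x_{N-1})`, with
`x_k` in `X (m + k)`, to `(d y + φ x₁, x₂, …, x_{N-1}, - ∑ k, d^{N-k} x_k)`. -/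
noncomputable def coneD (m : ℤ) : coneX φ m ⟶ coneX φ (m + 1) :=
  biprod.lift
    (biprod.fst ≫ Y.d m
      + biprod.snd ≫ X.shiftProj m 0 ≫ X.dd (m + 1 + (0 : ℕ)) (m + 1) ≫ φ.f (m + 1))
    (biprod.snd ≫ X.shiftD m)

theorem coneD_snd (m : ℤ) (n : ℕ) :
    dComp (coneX φ) (coneD φ) m (m + n) ≫ (biprod.snd : Y.X (m + n) ⊞ X.shiftX (m + n) ⟶ _)
      = (biprod.snd : Y.X m ⊞ X.shiftX m ⟶ _) ≫ X.shift.dd m (m + n) := by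
  induction n with
  | zero =>
    have e : m + ((0 : ℕ) : ℤ) = m := by simp
    rw [e, dComp_self, dd_self]
    change 𝟙 _ ≫ _ = _ ≫ 𝟙 _
    rw [Category.comp_id]
    exact Category.id_comp _
  | succ n ih =>
    have e : m + ((n + 1 : ℕ) : ℤ) = (m + n) + 1 := by push_cast; ring
    rw [e, ← dComp_comp _ _ (show m ≤ m + n by omega) (show m + (n : ℤ) ≤ m + n + 1 by omega),
      dComp_succ, Category.assoc]
    have e1 : coneD φ (m + n) ≫ (biprod.snd : Y.X (m + n + 1) ⊞ X.shiftX (m + n + 1) ⟶ _)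
        = (biprod.snd : Y.X (m + n) ⊞ X.shiftX (m + n) ⟶ _) ≫ X.shiftD (m + n) :=
      biprod.lift_snd _ _
    rw [e1, ← Category.assoc, ih, Category.assoc,
      ← X.shift.dd_comp (show m ≤ m + n by omega) (show m + (n : ℤ) ≤ m + n + 1 by omega), dd_succ]

theorem coneD_fst (m : ℤ) (n : ℕ) :
    dComp (coneX φ) (coneD φ) m (m + n) ≫ (biprod.fst : Y.X (m + n) ⊞ X.shiftX (m + n) ⟶ _)
      = (biprod.fst : Y.X m ⊞ X.shiftX m ⟶ _) ≫ Y.dd m (m + n)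
        + (biprod.snd : Y.X m ⊞ X.shiftX m ⟶ _) ≫
          (∑ k ∈ Finset.range n, X.shiftSeq m k (m + n)) ≫ φ.f (m + n) := by
  induction n with
  | zero =>
    have e : m + ((0 : ℕ) : ℤ) = m := by simp
    rw [e, dComp_self, dd_self, Finset.sum_range_zero, zero_comp, comp_zero, add_zero]
    change 𝟙 _ ≫ _ = _ ≫ 𝟙 _
    rw [Category.comp_id]
    exact Category.id_comp _
  | succ n ih =>
    have e : m + ((n + 1 : ℕ) : ℤ) = (m + n) + 1 := by push_cast; ring
    have h0 : ∀ a : ℤ, X.shiftProj a 0 ≫ X.dd (a + 1 + (0 : ℕ)) (a + 1) ≫ φ.f (a + 1)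
        = (X.shiftProj a 0 ≫ X.dd (a + 1 + (0 : ℕ)) (a + 1)) ≫ φ.f (a + 1) := by
      intro a; rw [Category.assoc]
    have h1 : ∀ a : ℤ, X.shiftProj a 0 ≫ X.dd (a + 1 + (0 : ℕ)) (a + 1)
        = X.shiftSeq a 0 (a + 1) := by
      intro a
      rw [shiftSeq]
      split_ifs with h1 h2
      · rfl
      · rw [shiftProj, dif_neg h1, ← h2]; simp
      · omega
    have e1 : coneD φ (m + n) ≫ (biprod.fst : Y.X (m + n + 1) ⊞ X.shiftX (m + n + 1) ⟶ _)
        = (biprod.fst : Y.X (m + n) ⊞ X.shiftX (m + n) ⟶ _) ≫ Y.d (m + n)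
          + (biprod.snd : Y.X (m + n) ⊞ X.shiftX (m + n) ⟶ _) ≫
            X.shiftSeq (m + n) 0 (m + n + 1) ≫ φ.f (m + n + 1) := by
      rw [← h1, ← h0]
      exact biprod.lift_fst _ _
    rw [e, ← dComp_comp _ _ (show m ≤ m + n by omega) (show m + (n : ℤ) ≤ m + n + 1 by omega),
      dComp_succ, Category.assoc, e1, Preadditive.comp_add, ← Category.assoc, ih,
      ← Category.assoc _ _ (X.shiftSeq (m + n) 0 (m + n + 1) ≫ φ.f (m + n + 1)), coneD_snd,
      Category.assoc, ← Category.assoc (X.shift.dd m (m + n)),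
      shift_dd_seq _ (by omega) 0 n (by push_cast; omega) (by push_cast; omega),
      Preadditive.add_comp, Category.assoc, ← Y.dd_succ, dd_comp _ (by omega) (by omega),
      Category.assoc, Category.assoc, ← dd_naturality, add_assoc (_ ≫ _), ← Preadditive.comp_add,
      ← Category.assoc (∑ k ∈ Finset.range n, X.shiftSeq m k (m + n)), ← Preadditive.add_comp,
      Finset.sum_range_succ, Preadditive.sum_comp]
    congr 4
    refine Finset.sum_congr rfl fun k hk => ?_
    rw [Finset.mem_range] at hk
    rw [shiftSeq_dd _ _ _ (by omega) (by omega)]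

/-- The mapping cone `C(φ)` of a morphism `φ : X ⟶ Y` of `N`-complexes. -/
noncomputable def cone : NComplex B N where
  X := coneX φ
  d := coneD φ
  dComp_eq_zero m := by
    refine biprod.hom_ext _ _ ?_ ?_
    · rw [coneD_fst, shiftSeq_sum, Y.dd_eq_zero le_rfl]
      simp
    · rw [coneD_snd, X.shift.dd_eq_zero le_rfl]
      simp

/-- The canonical morphism `Y ⟶ C(φ)`. -/
noncomputable def coneInr : Y ⟶ cone φ where
  f m := (biprod.inl : Y.X m ⟶ Y.X m ⊞ X.shiftX m)
  comm m := by
    refine biprod.hom_ext _ _ ?_ ?_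
    · simp [cone, coneD]
    · simp [cone, coneD]

/-- The canonical morphism `C(φ) ⟶ ΣX`. -/
noncomputable def coneSnd : cone φ ⟶ X.shift where
  f m := (biprod.snd : Y.X m ⊞ X.shiftX m ⟶ X.shiftX m)
  comm m := by
    change biprod.lift _ _ ≫ _ = _ ≫ X.shiftD m
    exact biprod.lift_snd _ _

end Cone

end NComplex

namespace KN

variable (B : Type u) [Category.{v} B] [Preadditive B] (N : ℕ)

/-- The full subcategory `F_s^r` of `K_N(B)`, closed under isomorphisms, on the `N`-complexes
whose `r` consecutive differentials starting in the degrees congruent to `s` modulo `N` are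
identities. -/
def F (s : ℤ) (r : ℕ) : ObjectProperty (KN B N) :=
  (NComplex.HasIdentities s r).map (quotient B N)

variable [HasFiniteBiproducts B]

/-- The suspension functor `Σ` on `K_N(B)`. -/
noncomputable def susp : KN B N ⥤ KN B N :=
  CategoryTheory.Quotient.lift _ (NComplex.shiftFunctor B N ⋙ quotient B N) (by
    intro X Y φ ψ h
    refine CategoryTheory.Quotient.sound _ ?_
    change NComplex.NullHomotopic (NComplex.shiftMap φ - NComplex.shiftMap ψ)
    rw [← NComplex.shiftMap_sub]
    exact NComplex.shiftMap_nullHomotopic h)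

variable {B N}

/-- The morphism `C(φ) ⟶ ΣX` in `K_N(B)` induced by the canonical morphism of `N`-complexes, for
`φ : X ⟶ Y`. -/
noncomputable def coneδ {X Y : NComplex B N} (φ : X ⟶ Y) :
    (quotient B N).obj (NComplex.cone φ) ⟶ (susp B N).obj ((quotient B N).obj X) :=
  (quotient B N).map (NComplex.coneSnd φ)

/-- The distinguished triangles `X ⟶ Y ⟶ Z ⟶ ΣX` of `K_N(B)`: those isomorphic to
`X' ⟶ Y' ⟶ C(φ) ⟶ ΣX'` for a morphism `φ : X' ⟶ Y'` of `N`-complexes. -/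
def IsDistTriangle {X Y Z : KN B N} (f : X ⟶ Y) (g : Y ⟶ Z) (h : Z ⟶ (susp B N).obj X) : Prop :=
  ∃ (X' Y' : NComplex B N) (φ : X' ⟶ Y') (a : X ≅ (quotient B N).obj X')
    (b : Y ≅ (quotient B N).obj Y') (c : Z ≅ (quotient B N).obj (NComplex.cone φ)),
    f ≫ b.hom = a.hom ≫ (quotient B N).map φ ∧
    g ≫ c.hom = b.hom ≫ (quotient B N).map (NComplex.coneInr φ) ∧
    h ≫ (susp B N).map a.hom = c.hom ≫ coneδ φ

/-- A pair `(U, V)` of full subcategories of the triangulated category `K_N(B)` is a stable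
t-structure. -/
structure IsStableTStructure (U V : ObjectProperty (KN B N)) : Prop where
  susp_left : U.map (susp B N) = U
  susp_right : V.map (susp B N) = V
  hom_eq_zero : ∀ ⦃X Y : KN B N⦄, U X → V Y → ∀ f : X ⟶ Y, f = 0
  exists_triangle : ∀ X : KN B N, ∃ (X₁ X₂ : KN B N) (f : X₁ ⟶ X) (g : X ⟶ X₂)
    (h : X₂ ⟶ (susp B N).obj X₁), U X₁ ∧ V X₂ ∧ IsDistTriangle f g h

end KN

/-!
The proof rests on pulling back complexes along monotone maps `b : ℤ → ℤ` (`NComplex.reindex`): the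
complex `X.reindex b` has the object `X (b m)` in degree `m`, and composites of differentials of `X`
as differentials. For `b ≤ c` the differentials give a morphism `X.reindex b ⟶ X.reindex c`.

Let `q := Reindexing.step` be the monotone map which takes the value `i` on
`i + r + 1 - N, …, i + r` for every `i ≡ s` modulo `N`. All differentials of `X.reindex q` are
identities, except for those from degree `i + r` to `i + r + 1`, which are composites of `N`
differentials and thus vanish. So `X.reindex q` is contractible. Moreover `X.reindex (min id q)` has
identities in the degrees required by `U = F_s^r`, and `X.reindex (max id q)` in those required by
`V = F_{r+s+1}^{N-r-1}`; conversely these reindexings do not change a complex which already has such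
identities.

* Triangles: there is a degreewise split exact sequence
  `X.reindex (min id q) ⟶ X ⊕ X.reindex q ⟶ X.reindex (max id q)` of Mayer–Vietoris type
  (`NComplex.degreewiseSplit_mayerVietoris`). Its middle term is isomorphic to `X` in `K_N(B)`, and
  a degreewise split exact sequence gives a distinguished triangle (`KN.exists_isDistTriangle`). The
  latter holds because a degreewise split epimorphism with contractible kernel is an isomorphism in
  `K_N(B)` (`KN.isIso_quotient_map`).
* Orthogonality: a morphism from `U` to `V` is, after these reindexings, a morphism
  `X.reindex (min id q) ⟶ Y.reindex (max id q)` that factors through `X.reindex q`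
  (`NComplex.HasIdentities.nullHomotopic`).
* Stability under `Σ`: leaving out the identities, one sees that `F_s^r` is the essential image of
  `K_M(B)` with `M = N - r` under the reindexing along `Reindexing.collapse`. This functor respects
  homotopies (`NComplex.NullHomotopic.reindex`) and degreewise split exact sequences, hence commutes
  with the suspension (`KN.nonempty_susp_reindex_iso`). As `Σ` is essentially surjective on `K_M(B)`
  (`KN.exists_susp_iso`), both inclusions between `Σ F_s^r` and `F_s^r` follow.
-/

/-! ### Chain maps, traces and contractible complexes -/

section dComp

variable {B : Type u} [Category.{v} B] [HasZeroMorphisms B]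

theorem dComp_naturality {X Y : ℤ → B} {dX : ∀ i, X i ⟶ X (i + 1)} {dY : ∀ i, Y i ⟶ Y (i + 1)}
    (f : ∀ i, X i ⟶ Y i) (comm : ∀ i, dX i ≫ f (i + 1) = f i ≫ dY i) (i j : ℤ) :
    dComp X dX i j ≫ f j = f i ≫ dComp Y dY i j := by
  by_cases h : i ≤ j
  · obtain ⟨n, rfl⟩ := Int.le.dest h
    clear h
    induction n with
    | zero =>
      obtain e : i + ((0 : ℕ) : ℤ) = i := by simp
      rw [e, dComp_self, dComp_self, Category.id_comp, Category.comp_id]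
    | succ n ih =>
      have e : i + ((n + 1 : ℕ) : ℤ) = (i + n) + 1 := by push_cast; ring
      rw [e, ← dComp_comp X dX (show i ≤ i + n by omega) (by omega),
        ← dComp_comp Y dY (show i ≤ i + n by omega) (by omega), dComp_succ, dComp_succ,
        Category.assoc, comm, ← Category.assoc, ih, Category.assoc]
  · simp [dComp, h]

end dComp

namespace NComplex

section Basic

variable {B : Type u} [Category.{v} B] [HasZeroMorphisms B] {N : ℕ}

theorem dd_of_lt (X : NComplex B N) {i j : ℤ} (h : j < i) : X.dd i j = 0 := by
  simp [dd, dComp, h]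

theorem isIso_of_isIso_f {X Y : NComplex B N} (φ : X ⟶ Y) (h : ∀ i, IsIso (φ.f i)) :
    IsIso φ := by
  refine ⟨⟨{ f := fun i => inv (φ.f i), comm := fun i => ?_ }, ?_, ?_⟩⟩
  · rw [IsIso.comp_inv_eq, Category.assoc, IsIso.eq_inv_comp, φ.comm]
  · ext i; simp
  · ext i; simp

end Basic

section Preadd

variable {B : Type u} [Category.{v} B] [Preadditive B] {N : ℕ}

/-- The null-homotopic chain map defined by a family `s i : X i ⟶ Y (i - N + 1)`. -/
def trace {X Y : NComplex B N} (s : ∀ i : ℤ, X.X i ⟶ Y.X (i - N + 1)) : X ⟶ Y where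
  f i := ∑ j ∈ Finset.range N, X.dd i (i + j) ≫ s (i + j) ≫ Y.dd (i + j - N + 1) i
  comm i := by
    -- Both sides are sums of consecutive terms of `G`, and the two boundary terms vanish.
    let G : ℕ → (X.X i ⟶ Y.X (i + 1)) := fun j =>
      X.dd i (i + j) ≫ s (i + j) ≫ Y.dd (i + j - N + 1) (i + 1)
    have cong : ∀ {a a' : ℤ}, a = a' → X.dd i a ≫ s a ≫ Y.dd (a - N + 1) (i + 1) =
        X.dd i a' ≫ s a' ≫ Y.dd (a' - N + 1) (i + 1) := by
      rintro a _ rfl; rfl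
    have e1 : X.d i ≫ ∑ j ∈ Finset.range N,
        X.dd (i + 1) (i + 1 + j) ≫ s (i + 1 + j) ≫ Y.dd (i + 1 + j - N + 1) (i + 1)
          = ∑ j ∈ Finset.range N, G (j + 1) := by
      rw [Preadditive.comp_sum]
      refine Finset.sum_congr rfl fun j _ => ?_
      rw [← X.dd_succ, ← Category.assoc, X.dd_comp (by omega) (by omega)]
      exact cong (by push_cast; ring)
    have e2 : (∑ j ∈ Finset.range N,
        X.dd i (i + j) ≫ s (i + j) ≫ Y.dd (i + j - N + 1) i) ≫ Y.d i
          = ∑ j ∈ Finset.range N, G j := by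
      rw [Preadditive.sum_comp]
      refine Finset.sum_congr rfl fun j hj => ?_
      rw [Finset.mem_range] at hj
      rw [← Y.dd_succ, Category.assoc, Category.assoc, Y.dd_comp (by omega) (by omega)]
    have h0 : G 0 = 0 := by
      simp only [G]
      rw [Y.dd_eq_zero (by push_cast; omega), comp_zero, comp_zero]
    have hN : G N = 0 := by
      simp only [G]
      rw [X.dd_eq_zero (by omega), zero_comp]
    have e3 := Finset.sum_range_succ G N
    rw [Finset.sum_range_succ', h0, hN, add_zero, add_zero] at e3
    rw [e1, e2, e3]

theorem trace_f {X Y : NComplex B N} (s : ∀ i : ℤ, X.X i ⟶ Y.X (i - N + 1)) (i : ℤ) :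
    (trace s).f i =
      ∑ j ∈ Finset.range N, X.dd i (i + j) ≫ s (i + j) ≫ Y.dd (i + j - N + 1) i := rfl

theorem nullHomotopic_trace {X Y : NComplex B N} (s : ∀ i : ℤ, X.X i ⟶ Y.X (i - N + 1)) :
    NullHomotopic (trace s) := ⟨s, fun _ => rfl⟩

theorem comp_trace {X Y Z : NComplex B N} (ψ : X ⟶ Y) (s : ∀ i : ℤ, Y.X i ⟶ Z.X (i - N + 1)) :
    ψ ≫ trace s = trace fun i => ψ.f i ≫ s i := by
  ext i
  rw [comp_f, trace_f, trace_f, Preadditive.comp_sum]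
  refine Finset.sum_congr rfl fun j _ => ?_
  rw [← Category.assoc, ← dd_naturality, Category.assoc, Category.assoc]

theorem trace_comp {X Y Z : NComplex B N} (s : ∀ i : ℤ, X.X i ⟶ Y.X (i - N + 1)) (ψ : Y ⟶ Z) :
    trace s ≫ ψ = trace fun i => s i ≫ ψ.f (i - N + 1) := by
  ext i
  rw [comp_f, trace_f, trace_f, Preadditive.sum_comp]
  refine Finset.sum_congr rfl fun j _ => ?_
  rw [Category.assoc, Category.assoc, Category.assoc, dd_naturality]

theorem trace_zero {X Y : NComplex B N} :
    trace (fun i => (0 : X.X i ⟶ Y.X (i - N + 1))) = 0 := by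
  ext i
  simp [trace_f]

/-- Every morphism of `1`-complexes is null-homotopic: its components are a null-homotopy. -/
theorem nullHomotopic_of_one {X Y : NComplex B 1} (φ : X ⟶ Y) : NullHomotopic φ := by
  refine ⟨fun i => φ.f i ≫ Y.dd i (i - (1 : ℕ) + 1), fun i => ?_⟩
  have cong : ∀ {a : ℤ}, a = i → φ.f i = X.dd i a ≫ (φ.f a ≫ Y.dd a (a - (1 : ℕ) + 1)) ≫
      Y.dd (a - (1 : ℕ) + 1) i := by
    rintro a rfl
    rw [Category.assoc, Y.dd_comp (by omega) (by omega), dd_self, dd_self, Category.comp_id,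
      Category.id_comp]
  rw [Finset.sum_range_one]
  exact cong (by simp)

/-- A contractibility criterion. The homotopy is `i ↦ φ i ≫ e i`; the hypotheses say that the
maps `φ ∘ d ^ k` with `k < N` are coordinates on `P` in which `P` is a direct sum of complexes
`G i = G i = ⋯ = G i` living in the degrees `i - N + 1, …, i`. -/
theorem nullHomotopic_id_of_coordinates (P : NComplex B N) (G : ℤ → B)
    (φ : ∀ i, P.X i ⟶ G i) (e : ∀ i : ℤ, G i ⟶ P.X (i - N + 1))
    (he : ∀ i, e i ≫ P.dd (i - N + 1) i ≫ φ i = 𝟙 (G i))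
    (he₀ : ∀ i j : ℤ, i - N + 1 ≤ j → j < i → e i ≫ P.dd (i - N + 1) j ≫ φ j = 0)
    (hφ : ∀ (i : ℤ) (u : P.X i ⟶ P.X i),
      (∀ k : ℕ, k < N → u ≫ P.dd i (i + k) ≫ φ (i + k) = 0) → u = 0) :
    NullHomotopic (𝟙 P) := by
  refine ⟨fun i => φ i ≫ e i, fun i => sub_eq_zero.1 (hφ i _ fun k hk => ?_)⟩
  rw [Preadditive.sub_comp, sub_eq_zero, id_f, Category.id_comp, Preadditive.sum_comp,
    Finset.sum_eq_single_of_mem k (Finset.mem_range.2 hk)]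
  · rw [Category.assoc, Category.assoc, Category.assoc, ← Category.assoc (P.dd _ i),
      P.dd_comp (by omega) (by omega), he, Category.comp_id]
  · intro j hj hjk
    rw [Finset.mem_range] at hj
    rw [Category.assoc, Category.assoc, Category.assoc, ← Category.assoc (P.dd _ i),
      P.dd_comp (by omega) (by omega)]
    rcases lt_or_gt_of_ne hjk with h | h
    · rw [P.dd_eq_zero (show i + j - N + 1 + N ≤ i + k by omega), zero_comp, comp_zero, comp_zero,
        comp_zero]
    · rw [he₀ _ _ (by omega) (by omega), comp_zero, comp_zero]

/-- A pair of morphisms of `N`-complexes which is a split short exact sequence in each degree. -/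
def DegreewiseSplit {X Y Z : NComplex B N} (α : X ⟶ Y) (β : Y ⟶ Z) : Prop :=
  ∀ i, ∃ (ρ : Y.X i ⟶ X.X i) (τ : Z.X i ⟶ Y.X i), α.f i ≫ ρ = 𝟙 (X.X i) ∧
    τ ≫ β.f i = 𝟙 (Z.X i) ∧ α.f i ≫ β.f i = 0 ∧ ρ ≫ α.f i + β.f i ≫ τ = 𝟙 (Y.X i)

/-- In a degreewise split exact sequence `X ⟶ Y ⟶ Z` with `X` contractible, `Y ⟶ Z` has a
section `θ` such that the idempotent `β ≫ θ` is homotopic to the identity: a contraction of `X`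
extends to a homotopy on `Y`, and subtracting its trace from `𝟙 Y` gives a map that kills `X`. -/
theorem DegreewiseSplit.exists_homotopyInverse {X Y Z : NComplex B N} {α : X ⟶ Y} {β : Y ⟶ Z}
    (h : DegreewiseSplit α β) (hX : NullHomotopic (𝟙 X)) :
    ∃ θ : Z ⟶ Y, θ ≫ β = 𝟙 Z ∧ NullHomotopic (𝟙 Y - β ≫ θ) := by
  choose ρ τ h1 h2 h3 h4 using h
  obtain ⟨s, hs⟩ := hX
  have hs' : trace s = 𝟙 X := hom_ext fun i => (hs i).symm
  let t : ∀ i : ℤ, Y.X i ⟶ Y.X (i - N + 1) := fun i => ρ i ≫ s i ≫ α.f (i - N + 1)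
  let p : Y ⟶ Y := 𝟙 Y - trace t
  have hp : ∀ i, α.f i ≫ p.f i = 0 := fun i => by
    have : α ≫ p = 0 := by
      simp only [p, Preadditive.comp_sub, comp_trace, t]
      rw [show (fun i => α.f i ≫ ρ i ≫ s i ≫ α.f (i - N + 1)) = fun i => s i ≫ α.f (i - N + 1) from
        funext fun i => by rw [← Category.assoc, h1, Category.id_comp], ← trace_comp, hs',
        Category.id_comp, Category.comp_id, sub_self]
    rw [← comp_f, this, zero_f]
  have hβp : ∀ i, β.f i ≫ τ i ≫ p.f i = p.f i := fun i => by
    have : (ρ i ≫ α.f i + β.f i ≫ τ i) ≫ p.f i = p.f i := by rw [h4, Category.id_comp]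
    rwa [Preadditive.add_comp, Category.assoc, hp, comp_zero, zero_add, Category.assoc] at this
  have hpβ : p ≫ β = β := by
    simp only [p, Preadditive.sub_comp, trace_comp, t, Category.assoc, h3, comp_zero]
    rw [trace_zero, Category.id_comp, sub_zero]
  have hτβ : ∀ i, τ i ≫ p.f i ≫ β.f i = 𝟙 _ := fun i => by
    rw [← comp_f, hpβ, h2]
  refine ⟨{ f := fun i => τ i ≫ p.f i, comm := fun i => ?_ }, ?_, ?_⟩
  · have : β.f i ≫ Z.d i ≫ τ (i + 1) ≫ p.f (i + 1) = β.f i ≫ (τ i ≫ p.f i) ≫ Y.d i := by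
      rw [← Category.assoc, ← β.comm, Category.assoc, hβp, p.comm, Category.assoc,
        ← Category.assoc, ← Category.assoc, Category.assoc (β.f i), hβp]
    rw [← Category.id_comp (Z.d i ≫ _), ← Category.id_comp ((τ i ≫ p.f i) ≫ _), ← h2,
      Category.assoc, this, Category.assoc, Category.assoc]
  · ext i
    simp [hτβ]
  · convert nullHomotopic_trace t
    rw [sub_eq_iff_eq_add, ← sub_eq_iff_eq_add']
    ext i
    exact (hβp i).symm

end Preadd

end NComplex

namespace KN

variable {B : Type u} [Category.{v} B] [Preadditive B] {N : ℕ}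

instance : (quotient B N).Full :=
  inferInstanceAs (CategoryTheory.Quotient.functor (NComplex.homotopic B N)).Full

theorem quotient_map_eq {X Y : NComplex B N} {φ ψ : X ⟶ Y}
    (h : NComplex.NullHomotopic (φ - ψ)) : (quotient B N).map φ = (quotient B N).map ψ :=
  CategoryTheory.Quotient.sound _ h

theorem quotient_map_eq_zero {X Y : NComplex B N} {φ : X ⟶ Y}
    (h : NComplex.NullHomotopic φ) : (quotient B N).map φ = 0 :=
  quotient_map_eq (ψ := 0) (by rwa [sub_zero])

theorem nonempty_iso_of_nullHomotopic_id {X Y : NComplex B N}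
    (hX : NComplex.NullHomotopic (𝟙 X)) (hY : NComplex.NullHomotopic (𝟙 Y)) :
    Nonempty ((quotient B N).obj X ≅ (quotient B N).obj Y) :=
  ⟨0, 0, by rw [comp_zero, ← CategoryTheory.Functor.map_id, quotient_map_eq_zero hX],
    by rw [comp_zero, ← CategoryTheory.Functor.map_id, quotient_map_eq_zero hY]⟩

/-- A degreewise split epimorphism with contractible kernel is an isomorphism in `K_N(B)`. -/
theorem isIso_quotient_map {X Y Z : NComplex B N} {α : X ⟶ Y} {β : Y ⟶ Z}
    (h : NComplex.DegreewiseSplit α β) (hX : NComplex.NullHomotopic (𝟙 X)) :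
    IsIso ((quotient B N).map β) := by
  obtain ⟨θ, h1, h2⟩ := h.exists_homotopyInverse hX
  refine ⟨(quotient B N).map θ, ?_, ?_⟩
  · rw [← Functor.map_comp, ← CategoryTheory.Functor.map_id]
    exact (quotient_map_eq h2).symm
  · rw [← Functor.map_comp, h1, CategoryTheory.Functor.map_id]

end KN

/-! ### Mapping cones and degreewise split exact sequences -/

namespace NComplex

attribute [local instance] hasBinaryBiproducts_of_finite_biproducts

variable {B : Type u} [Category.{v} B] [Preadditive B] [HasFiniteBiproducts B] {N : ℕ}

/-- The morphism `X j ⟶ X (m + 1) ⊕ ⋯ ⊕ X (m + N - 1)` into the last summand given by the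
differentials. It is only used for `j = m + N - 1`, where it is the inclusion. -/
noncomputable def shiftLast (X : NComplex B N) (j m : ℤ) : X.X j ⟶ X.shiftX m :=
  X.shiftLift m fun k => if k + 2 = N then X.dd j (m + 1 + k) else 0

theorem shiftLast_seq (X : NComplex B N) (hN : 2 ≤ N) {j m c : ℤ} (hj : j + 1 = m + N) (k : ℕ)
    (hc : m + 1 + k ≤ c) :
    X.shiftLast j m ≫ X.shiftSeq m k c =
      if k + 2 = N then X.dd j c else if k + 1 = N then -X.dd j c else 0 := by
  have step : ∀ k : ℕ, k < N - 1 → m + 1 + k ≤ c →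
      X.shiftLast j m ≫ X.shiftProj m k ≫ X.dd (m + 1 + k) c =
        if k + 2 = N then X.dd j c else 0 := by
    intro k hk hc
    rw [shiftLast, ← Category.assoc, shiftLift_proj _ _ _ hk]
    split_ifs with h1
    · rw [dd_comp _ (by omega) (by omega)]
    · rw [zero_comp]
  rw [shiftSeq]
  by_cases h1 : k < N - 1
  · rw [if_pos h1, step k h1 hc, if_neg (show ¬ k + 1 = N by omega)]
  · rw [if_neg h1, if_neg (show ¬ k + 2 = N by omega)]
    by_cases h2 : k = N - 1
    · rw [if_pos h2, if_pos (by omega), Preadditive.comp_neg, Preadditive.comp_sum,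
        Finset.sum_congr rfl fun l hl => step l (Finset.mem_range.1 hl)
          (by rw [Finset.mem_range] at hl; omega),
        Finset.sum_eq_single_of_mem (N - 2) (Finset.mem_range.2 (by omega)), if_pos (by omega)]
      intro l _ hl
      rw [if_neg (by omega)]
    · rw [if_neg h2, if_neg (by omega), comp_zero]

section Cone

variable {X Y : NComplex B N} (φ : X ⟶ Y)

/-- The projection of `Y m ⊕ X (m + 1) ⊕ ⋯ ⊕ X (m + N - 1)` onto `Y m`. -/
noncomputable def coneFst (m : ℤ) : (cone φ).X m ⟶ Y.X m :=
  (biprod.fst : Y.X m ⊞ X.shiftX m ⟶ Y.X m)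

/-- The inclusion of `X (m + 1) ⊕ ⋯ ⊕ X (m + N - 1)` into
`Y m ⊕ X (m + 1) ⊕ ⋯ ⊕ X (m + N - 1)`. -/
noncomputable def coneInl (m : ℤ) : X.shiftX m ⟶ (cone φ).X m :=
  (biprod.inr : X.shiftX m ⟶ Y.X m ⊞ X.shiftX m)

@[simp]
theorem coneInr_coneFst (m : ℤ) : (coneInr φ).f m ≫ coneFst φ m = 𝟙 (Y.X m) := biprod.inl_fst

@[simp]
theorem coneInr_coneSnd (m : ℤ) : (coneInr φ).f m ≫ (coneSnd φ).f m = 0 := biprod.inl_snd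

@[simp]
theorem coneInl_coneFst (m : ℤ) : coneInl φ m ≫ coneFst φ m = 0 := biprod.inr_fst

@[simp]
theorem coneInl_coneSnd (m : ℤ) : coneInl φ m ≫ (coneSnd φ).f m = 𝟙 (X.shiftX m) :=
  biprod.inr_snd

@[simp]
theorem coneInr_coneFst_assoc (m : ℤ) {T : B} (g : Y.X m ⟶ T) :
    (coneInr φ).f m ≫ coneFst φ m ≫ g = g := by
  rw [← Category.assoc, coneInr_coneFst, Category.id_comp]

@[simp]
theorem coneInr_coneSnd_assoc (m : ℤ) {T : B} (g : X.shiftX m ⟶ T) :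
    (coneInr φ).f m ≫ (coneSnd φ).f m ≫ g = 0 := by
  rw [← Category.assoc, coneInr_coneSnd, zero_comp]

@[simp]
theorem coneInl_coneFst_assoc (m : ℤ) {T : B} (g : Y.X m ⟶ T) :
    coneInl φ m ≫ coneFst φ m ≫ g = 0 := by
  rw [← Category.assoc, coneInl_coneFst, zero_comp]

@[simp]
theorem coneInl_coneSnd_assoc (m : ℤ) {T : B} (g : X.shiftX m ⟶ T) :
    coneInl φ m ≫ (coneSnd φ).f m ≫ g = g := by
  rw [← Category.assoc, coneInl_coneSnd, Category.id_comp]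

theorem cone_hom_ext {m : ℤ} {T : B} {g g' : T ⟶ (cone φ).X m}
    (h₁ : g ≫ coneFst φ m = g' ≫ coneFst φ m)
    (h₂ : g ≫ (coneSnd φ).f m = g' ≫ (coneSnd φ).f m) : g = g' :=
  biprod.hom_ext _ _ h₁ h₂

theorem cone_total (m : ℤ) :
    coneFst φ m ≫ (coneInr φ).f m + (coneSnd φ).f m ≫ coneInl φ m = 𝟙 ((cone φ).X m) :=
  biprod.total

theorem cone_d_fst (m : ℤ) :
    (cone φ).d m ≫ coneFst φ (m + 1) = coneFst φ m ≫ Y.d m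
      + (coneSnd φ).f m ≫ X.shiftProj m 0 ≫ X.dd (m + 1 + (0 : ℕ)) (m + 1) ≫ φ.f (m + 1) :=
  biprod.lift_fst _ _

theorem cone_dd_fst {m j : ℤ} {n : ℕ} (h : m + n = j) :
    (cone φ).dd m j ≫ coneFst φ j = coneFst φ m ≫ Y.dd m j
      + (coneSnd φ).f m ≫ (∑ k ∈ Finset.range n, X.shiftSeq m k j) ≫ φ.f j := by
  subst h
  exact coneD_fst φ m n

end Cone

/-- The cone of an identity morphism is contractible: the maps `d ^ k : C(𝟙 X) i ⟶ X (i + k)`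
followed by the projection onto `X` are coordinates as in `nullHomotopic_id_of_coordinates`. -/
theorem nullHomotopic_id_cone_id (X : NComplex B N) (hN : 1 ≤ N) :
    NullHomotopic (𝟙 (cone (𝟙 X))) := by
  obtain rfl | hN := hN.eq_or_lt
  · exact nullHomotopic_of_one _
  refine nullHomotopic_id_of_coordinates _ X.X (coneFst (𝟙 X))
    (fun i => X.shiftLast i (i - N + 1) ≫ coneInl (𝟙 X) (i - N + 1)) ?_ ?_ ?_
  · intro i
    rw [cone_dd_fst (n := N - 1) _ (by omega), Preadditive.comp_add, Category.assoc, Category.assoc,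
      coneInl_coneFst_assoc, comp_zero, zero_add, coneInl_coneSnd_assoc, id_f, Category.comp_id,
      Preadditive.comp_sum, Finset.sum_eq_single_of_mem (N - 2) (Finset.mem_range.2 (by omega)),
      X.shiftLast_seq hN (by omega) _ (by omega), if_pos (by omega), dd_self]
    intro k hk hk'
    rw [Finset.mem_range] at hk
    rw [X.shiftLast_seq hN (by omega) _ (by omega), if_neg (by omega), if_neg (by omega)]
  · intro i j h h'
    rw [cone_dd_fst (n := (j - (i - N + 1)).toNat) _ (by omega), Preadditive.comp_add,
      Category.assoc, Category.assoc,
      coneInl_coneFst_assoc, comp_zero, zero_add, coneInl_coneSnd_assoc, id_f, Category.comp_id,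
      Preadditive.comp_sum]
    refine Finset.sum_eq_zero fun k hk => ?_
    rw [Finset.mem_range] at hk
    -- Only the last summand of `ΣX` is nonzero, and it has not yet moved to the first place.
    rw [shiftSeq, if_pos (by omega), ← Category.assoc, shiftLast, shiftLift_proj _ _ _ (by omega),
      if_neg (by omega), zero_comp]
  · intro i u hu
    have h0 : u ≫ coneFst (𝟙 X) i = 0 := by
      have := hu 0 (by omega)
      rwa [show i + ((0 : ℕ) : ℤ) = i by simp, dd_self, Category.id_comp] at this
    have h1 : ∀ k : ℕ, k < N - 1 → u ≫ (coneSnd (𝟙 X)).f i ≫ X.shiftProj i k = 0 := by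
      intro k
      induction k using Nat.strong_induction_on with
      | _ k ih =>
        intro hk
        have := hu (k + 1) (by omega)
        rw [cone_dd_fst _ rfl, Finset.sum_range_succ, id_f, Category.comp_id, Preadditive.comp_add,
          ← Category.assoc, h0, zero_comp, zero_add, Preadditive.comp_add, Preadditive.comp_add,
          Preadditive.comp_sum, Preadditive.comp_sum, Finset.sum_eq_zero, zero_add] at this
        · rw [← shiftSeq_eq_proj _ _ _ hk]
          rwa [show i + ((k + 1 : ℕ) : ℤ) = i + 1 + k by push_cast; ring] at this
        · intro l hl
          rw [Finset.mem_range] at hl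
          rw [shiftSeq, if_pos (by omega), ← Category.assoc, ← Category.assoc, Category.assoc u,
            ih l hl (by omega), zero_comp]
    refine cone_hom_ext _ (by rw [h0, zero_comp]) ?_
    refine X.shift_ext fun k hk => ?_
    rw [Category.assoc, h1 k hk, zero_comp, zero_comp]

/-- The morphism of mapping cones from `C(𝟙 X)` to `C(α)`. -/
noncomputable def coneIdMap {X Y : NComplex B N} (α : X ⟶ Y) : cone (𝟙 X) ⟶ cone α where
  f m := coneFst (𝟙 X) m ≫ α.f m ≫ (coneInr α).f m + (coneSnd (𝟙 X)).f m ≫ coneInl α m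
  comm m := by
    refine cone_hom_ext _ ?_ ?_
    · rw [Category.assoc, Category.assoc, Preadditive.add_comp, Preadditive.add_comp,
        cone_d_fst]
      simp only [Category.assoc, coneInr_coneFst, coneInl_coneFst, comp_zero, add_zero,
        Category.comp_id, Preadditive.comp_add, coneInr_coneFst_assoc, coneInl_coneFst_assoc,
        coneInr_coneSnd_assoc, coneInl_coneSnd_assoc, zero_add, ← α.comm]
      rw [← Category.assoc, cone_d_fst, Preadditive.add_comp]
      simp
    · rw [Category.assoc, Category.assoc, (coneSnd α).comm, Preadditive.add_comp,
        Preadditive.add_comp]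
      simp only [Category.assoc, coneInr_coneSnd, coneInl_coneSnd, comp_zero, zero_add,
        Category.comp_id, coneInr_coneSnd_assoc, coneInl_coneSnd_assoc, (coneSnd (𝟙 X)).comm]

/-- The morphism `C(α) ⟶ Z` which is `β` on `Y` and zero on the other summands. -/
noncomputable def coneDesc {X Y Z : NComplex B N} (α : X ⟶ Y) (β : Y ⟶ Z)
    (h : ∀ i, α.f i ≫ β.f i = 0) : cone α ⟶ Z where
  f m := coneFst α m ≫ β.f m
  comm m := by
    rw [← Category.assoc, cone_d_fst, Preadditive.add_comp]
    simp [β.comm, h]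

theorem DegreewiseSplit.coneIdMap_coneDesc {X Y Z : NComplex B N} {α : X ⟶ Y} {β : Y ⟶ Z}
    (h : DegreewiseSplit α β) (h₀ : ∀ i, α.f i ≫ β.f i = 0) :
    DegreewiseSplit (coneIdMap α) (coneDesc α β h₀) := by
  intro i
  obtain ⟨ρ, τ, h1, h2, h3, h4⟩ := h i
  refine ⟨coneFst α i ≫ ρ ≫ (coneInr (𝟙 X)).f i + (coneSnd α).f i ≫ coneInl (𝟙 X) i,
    τ ≫ (coneInr α).f i, ?_, ?_, ?_, ?_⟩
  · rw [← cone_total (𝟙 X) i]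
    simp [coneIdMap, ← Category.assoc (α.f i) ρ, h1]
  · simp [coneDesc, h2]
  · simp [coneIdMap, coneDesc, h3]
  · rw [← cone_total α i]
    simp only [coneIdMap, coneDesc, Preadditive.comp_add, Preadditive.add_comp, Category.assoc,
      coneInr_coneFst_assoc, coneInl_coneFst_assoc, coneInr_coneSnd_assoc, coneInl_coneSnd_assoc,
      comp_zero, add_zero, zero_add]
    rw [add_right_comm, ← Preadditive.comp_add, ← Category.assoc ρ, ← Category.assoc (β.f i),
      ← Preadditive.add_comp, h4, Category.id_comp]

theorem degreewiseSplit_coneInr_coneSnd {X Y : NComplex B N} (φ : X ⟶ Y) :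
    DegreewiseSplit (coneInr φ) (coneSnd φ) := fun i =>
  ⟨coneFst φ i, coneInl φ i, coneInr_coneFst φ i, coneInl_coneSnd φ i, coneInr_coneSnd φ i,
    cone_total φ i⟩

end NComplex

namespace KN

variable {B : Type u} [Category.{v} B] [Preadditive B] [HasFiniteBiproducts B] {N : ℕ}

/-- The third term of a degreewise split exact sequence `X ⟶ Y ⟶ Z` is isomorphic to the mapping
cone: `C(α) ⟶ Z` is degreewise a split epimorphism whose kernel is the contractible complex
`C(𝟙 X)`. -/
theorem nonempty_cone_iso (hN : 1 ≤ N) {X Y Z : NComplex B N} {α : X ⟶ Y} {β : Y ⟶ Z}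
    (h : NComplex.DegreewiseSplit α β) :
    Nonempty ((quotient B N).obj (NComplex.cone α) ≅ (quotient B N).obj Z) := by
  have h₀ : ∀ i, α.f i ≫ β.f i = 0 := fun i => by
    obtain ⟨_, _, _, _, h, _⟩ := h i
    exact h
  have := isIso_quotient_map (h.coneIdMap_coneDesc h₀) (NComplex.nullHomotopic_id_cone_id X hN)
  exact ⟨asIso ((quotient B N).map (NComplex.coneDesc α β h₀))⟩

/-- If the middle term of a degreewise split exact sequence is contractible, the third term is the
suspension of the first one: both are isomorphic to the mapping cone. -/
theorem nonempty_susp_iso (hN : 1 ≤ N) {X Y Z : NComplex B N} {α : X ⟶ Y} {β : Y ⟶ Z}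
    (h : NComplex.DegreewiseSplit α β) (hY : NComplex.NullHomotopic (𝟙 Y)) :
    Nonempty ((susp B N).obj ((quotient B N).obj X) ≅ (quotient B N).obj Z) := by
  obtain ⟨e⟩ := nonempty_cone_iso hN h
  have := isIso_quotient_map (NComplex.degreewiseSplit_coneInr_coneSnd α) hY
  exact ⟨(asIso ((quotient B N).map (NComplex.coneSnd α))).symm ≪≫ e⟩

/-- A degreewise split exact sequence `X ⟶ Y ⟶ Z` gives a distinguished triangle. -/
theorem exists_isDistTriangle (hN : 1 ≤ N) {X Y Z : NComplex B N} {α : X ⟶ Y} {β : Y ⟶ Z}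
    (h : NComplex.DegreewiseSplit α β) {W : KN B N} (b : W ≅ (quotient B N).obj Y) :
    ∃ (f : (quotient B N).obj X ⟶ W) (g : W ⟶ (quotient B N).obj Z)
      (h : (quotient B N).obj Z ⟶ (susp B N).obj ((quotient B N).obj X)),
      IsDistTriangle f g h := by
  obtain ⟨c⟩ := nonempty_cone_iso hN h
  refine ⟨(quotient B N).map α ≫ b.inv, b.hom ≫ (quotient B N).map (NComplex.coneInr α) ≫ c.hom,
    c.inv ≫ coneδ α, X, Y, α, Iso.refl _, b, c.symm, ?_, ?_, ?_⟩ <;> simp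

end KN

/-! ### Reindexing -/

/-- A monotone map `b : ℤ → ℤ` with `b m + M ≤ b (m + N)`. Pulling back an `M`-complex along `b`
gives an `N`-complex, see `NComplex.reindex`. -/
structure Reindexing (M N : ℕ) where
  toFun : ℤ → ℤ
  monotone : Monotone toFun
  add_le : ∀ m, toFun m + M ≤ toFun (m + N)

namespace Reindexing

instance (M N : ℕ) : CoeFun (Reindexing M N) fun _ => ℤ → ℤ := ⟨toFun⟩

variable {L M N : ℕ}

theorem le_succ (b : Reindexing M N) (m : ℤ) : b m ≤ b (m + 1) := b.monotone (by omega)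

/-- The identity map of `ℤ`. -/
def id (N : ℕ) : Reindexing N N := ⟨fun m => m, monotone_id, fun _ => le_rfl⟩

/-- The translation by `n`. -/
def translation (N : ℕ) (n : ℤ) : Reindexing N N :=
  ⟨fun m => m + n, fun _ _ h => by simpa using h, fun m => by omega⟩

/-- The composite of two reindexings. -/
def comp (c : Reindexing L M) (b : Reindexing M N) : Reindexing L N :=
  ⟨fun m => c (b m), c.monotone.comp b.monotone,
    fun m => (c.add_le (b m)).trans (c.monotone (b.add_le m))⟩

/-- The pointwise minimum of two reindexings. -/
def inf (b c : Reindexing M N) : Reindexing M N :=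
  ⟨fun m => min (b m) (c m), b.monotone.min c.monotone,
    fun m => by have := b.add_le m; have := c.add_le m; omega⟩

/-- The pointwise maximum of two reindexings. -/
def sup (b c : Reindexing M N) : Reindexing M N :=
  ⟨fun m => max (b m) (c m), b.monotone.max c.monotone,
    fun m => by have := b.add_le m; have := c.add_le m; omega⟩

end Reindexing

namespace NComplex

section Basic

variable {B : Type u} [Category.{v} B] [HasZeroMorphisms B] {L M N : ℕ}

theorem dComp_reindex (X : NComplex B M) (b : Reindexing M N) {i j : ℤ} (h : i ≤ j) :
    dComp (fun m => X.X (b m)) (fun m => X.dd (b m) (b (m + 1))) i j = X.dd (b i) (b j) := by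
  obtain ⟨n, rfl⟩ := Int.le.dest h
  clear h
  induction n with
  | zero =>
    have e : i + ((0 : ℕ) : ℤ) = i := by simp
    rw [e, dComp_self, dd_self]
  | succ n ih =>
    have e : i + ((n + 1 : ℕ) : ℤ) = (i + n) + 1 := by push_cast; ring
    rw [e, ← dComp_comp _ _ (show i ≤ i + n by omega) (by omega), ih, dComp_succ,
      X.dd_comp (b.monotone (by omega)) (b.le_succ _)]

/-- The `N`-complex with objects `X (b m)` whose differentials are composites of differentials
of the `M`-complex `X`. -/
def reindex (X : NComplex B M) (b : Reindexing M N) : NComplex B N where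
  X m := X.X (b m)
  d m := X.dd (b m) (b (m + 1))
  dComp_eq_zero m := by
    rw [dComp_reindex X b (by omega), X.dd_eq_zero (b.add_le m)]

theorem reindex_dd (X : NComplex B M) (b : Reindexing M N) {i j : ℤ} (h : i ≤ j) :
    (X.reindex b).dd i j = X.dd (b i) (b j) := dComp_reindex X b h

/-- Reindexing on morphisms. -/
def reindexMap {X Y : NComplex B M} (φ : X ⟶ Y) (b : Reindexing M N) :
    X.reindex b ⟶ Y.reindex b where
  f m := φ.f (b m)
  comm _ := dd_naturality φ _ _

variable (B) in
/-- Reindexing as a functor. -/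
def reindexFunctor (b : Reindexing M N) : NComplex B M ⥤ NComplex B N where
  obj X := X.reindex b
  map φ := reindexMap φ b

/-- The morphism from `X.reindex b` to `X.reindex c` given by the differentials, for `b ≤ c`. -/
def reindexTrans (X : NComplex B M) {b c : Reindexing M N} (h : ∀ m, b m ≤ c m) :
    X.reindex b ⟶ X.reindex c where
  f m := X.dd (b m) (c m)
  comm m := by
    change X.dd _ _ ≫ X.dd _ _ = X.dd _ _ ≫ X.dd _ _
    rw [X.dd_comp (b.le_succ m) (h _), X.dd_comp (h m) (c.le_succ m)]

/-- Reindexing along the identity does nothing. -/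
def reindexId (X : NComplex B N) : X.reindex (Reindexing.id N) ≅ X where
  hom := { f := fun m => 𝟙 (X.X m)
           comm := fun m => by
             change X.dd m (m + 1) ≫ _ = _
             rw [dd_succ]
             exact (Category.comp_id _).trans (Category.id_comp _).symm }
  inv := { f := fun m => 𝟙 (X.X m)
           comm := fun m => by
             change _ = _ ≫ X.dd m (m + 1)
             rw [dd_succ]
             exact (Category.comp_id _).trans (Category.id_comp _).symm }
  hom_inv_id := hom_ext fun m => Category.comp_id _
  inv_hom_id := hom_ext fun m => Category.comp_id _

/-- Reindexing twice is reindexing along the composite. -/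
def reindexComp (X : NComplex B L) (c : Reindexing L M) (b : Reindexing M N) :
    (X.reindex c).reindex b ≅ X.reindex (c.comp b) where
  hom := { f := fun m => 𝟙 (X.X (c (b m)))
           comm := fun m => by
             change (X.reindex c).dd (b m) (b (m + 1)) ≫ 𝟙 _ = 𝟙 _ ≫ X.dd _ _
             rw [reindex_dd _ _ (b.le_succ m)]
             exact (Category.comp_id _).trans (Category.id_comp _).symm }
  inv := { f := fun m => 𝟙 (X.X (c (b m)))
           comm := fun m => by
             change X.dd _ _ ≫ 𝟙 _ = 𝟙 _ ≫ (X.reindex c).dd (b m) (b (m + 1))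
             rw [reindex_dd _ _ (b.le_succ m)]
             exact (Category.comp_id _).trans (Category.id_comp _).symm }
  hom_inv_id := hom_ext fun m => Category.comp_id _
  inv_hom_id := hom_ext fun m => Category.comp_id _

/-- Reindexing along a map `b` with `b m ≤ m` does not change an `N`-complex whose differentials
from `X (b m)` to `X m` are isomorphisms. -/
theorem nonempty_reindex_iso_of_le (X : NComplex B N) (b : Reindexing N N) (hb : ∀ m, b m ≤ m)
    (h : ∀ m, IsIso (X.dd (b m) m)) : Nonempty (X.reindex b ≅ X) := by
  have := isIso_of_isIso_f (X.reindexTrans (b := b) (c := Reindexing.id N) hb) h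
  exact ⟨asIso (X.reindexTrans (b := b) (c := Reindexing.id N) hb) ≪≫ X.reindexId⟩

/-- The composite of `φ` with differentials on both sides depends only on the outer degrees. -/
theorem dd_comp_f_comp_dd {X Y : NComplex B N} (φ : X ⟶ Y) {i j k l : ℤ} (hij : i ≤ j)
    (hik : i ≤ k) (hjl : j ≤ l) (hkl : k ≤ l) :
    X.dd i j ≫ φ.f j ≫ Y.dd j l = X.dd i k ≫ φ.f k ≫ Y.dd k l := by
  rw [← Category.assoc, ← Category.assoc, dd_naturality, dd_naturality, Category.assoc,
    Category.assoc, Y.dd_comp hij hjl, Y.dd_comp hik hkl]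

end Basic

section Preadd

variable {B : Type u} [Category.{v} B] [Preadditive B] {M N : ℕ}

theorem DegreewiseSplit.reindex {X Y Z : NComplex B M} {α : X ⟶ Y} {β : Y ⟶ Z}
    (h : DegreewiseSplit α β) (b : Reindexing M N) :
    DegreewiseSplit ((reindexFunctor B b).map α) ((reindexFunctor B b).map β) :=
  fun m => h (b m)

/-- Summing `F ∘ b` over the last elements of the fibres of `b` is summing `F` over the values
of `b`. -/
theorem sum_range_steps {A : Type*} [AddCommMonoid A] {b : ℤ → ℤ}
    (hb : ∀ m, b (m + 1) = b m ∨ b (m + 1) = b m + 1) (F : ℤ → A) (m : ℤ) (n : ℕ) :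
    ∑ j ∈ Finset.range n, (if b (m + j + 1) = b (m + j) + 1 then F (b (m + j)) else 0) =
      ∑ k ∈ Finset.range (b (m + n) - b m).toNat, F (b m + k) := by
  have mono : Monotone b := monotone_int_of_le_succ fun m => by have := hb m; omega
  induction n with
  | zero => simp
  | succ n ih =>
    have e : m + ((n + 1 : ℕ) : ℤ) = m + n + 1 := by push_cast; ring
    have h1 : b m ≤ b (m + n) := mono (by omega)
    rw [Finset.sum_range_succ, ih, e]
    rcases hb (m + n) with h | h
    · rw [if_neg (by omega), h, add_zero]
    · rw [if_pos h, h, show (b (m + n) + 1 - b m).toNat = (b (m + n) - b m).toNat + 1 by omega,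
        Finset.sum_range_succ]
      congr 2
      omega

/-- If `b` makes steps of size at most one, and `M` steps in every interval of length `N`, then
reindexing along `b` preserves null-homotopic morphisms. In the `N`-homotopy
`s (b i) ≫ d : X (b i) ⟶ Y (b (i - N + 1))` the factor `d` is an identity if `i` is the last element
of a fibre of `b`, and zero otherwise, since then its source lies above its target. -/
theorem NullHomotopic.reindex (b : Reindexing M N)
    (hb : ∀ m, b (m + 1) = b m ∨ b (m + 1) = b m + 1) (hb' : ∀ m, b (m + N) = b m + M)
    {X Y : NComplex B M} {φ : X ⟶ Y} (h : NullHomotopic φ) :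
    NullHomotopic ((reindexFunctor B b).map φ) := by
  obtain ⟨s, hs⟩ := h
  refine ⟨fun i => s (b i) ≫ Y.dd (b i - M + 1) (b (i - N + 1)), fun i => ?_⟩
  change φ.f (b i) = ∑ j ∈ Finset.range N, (X.reindex b).dd i (i + j) ≫
    (s (b (i + j)) ≫ Y.dd (b (i + j) - M + 1) (b (i + j - N + 1))) ≫
      (Y.reindex b).dd (i + j - N + 1) i
  let F : ℤ → (X.X (b i) ⟶ Y.X (b i)) := fun a => X.dd (b i) a ≫ s a ≫ Y.dd (a - M + 1) (b i)
  have key : ∀ j ∈ Finset.range N, (X.reindex b).dd i (i + j) ≫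
      (s (b (i + j)) ≫ Y.dd (b (i + j) - M + 1) (b (i + j - N + 1))) ≫
        (Y.reindex b).dd (i + j - N + 1) i =
      if b (i + j + 1) = b (i + j) + 1 then F (b (i + j)) else 0 := by
    intro j hj
    rw [Finset.mem_range] at hj
    have e := hb' (i + j - N + 1)
    rw [show i + j - N + 1 + (N : ℤ) = i + j + 1 by ring] at e
    have hm : b (i + j - N + 1) ≤ b i := b.monotone (by omega)
    rw [reindex_dd _ _ (by omega), reindex_dd _ _ (by omega)]
    change X.dd (b i) (b (i + j)) ≫ (s (b (i + j)) ≫ Y.dd (b (i + j) - M + 1) (b (i + j - N + 1)))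
      ≫ Y.dd (b (i + j - N + 1)) (b i) = _
    split_ifs with h
    · rw [Category.assoc, Y.dd_comp (by omega) hm]
    · have := hb (i + j)
      rw [Y.dd_of_lt (show b (i + j - N + 1) < b (i + j) - M + 1 by omega), comp_zero, zero_comp,
        comp_zero]
  have e := sum_range_steps hb F i N
  rw [hb', show (b i + M - b i).toNat = M by omega] at e
  exact (hs _).trans (e.symm.trans (Finset.sum_congr rfl key).symm)

end Preadd

section MayerVietoris

attribute [local instance] hasBinaryBiproducts_of_finite_biproducts

variable {B : Type u} [Category.{v} B] [Preadditive B] [HasFiniteBiproducts B] {M N : ℕ}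

/-- The direct sum of two `N`-complexes. -/
noncomputable def directSum (X Y : NComplex B N) : NComplex B N where
  X m := X.X m ⊞ Y.X m
  d m := biprod.map (X.d m) (Y.d m)
  dComp_eq_zero m := by
    refine biprod.hom_ext _ _ ?_ ?_
    · rw [dComp_naturality (fun m => (biprod.fst : X.X m ⊞ Y.X m ⟶ _))
        (fun i => biprod.map_fst _ _), X.dComp_eq_zero, comp_zero, zero_comp]
    · rw [dComp_naturality (fun m => (biprod.snd : X.X m ⊞ Y.X m ⟶ _))
        (fun i => biprod.map_snd _ _), Y.dComp_eq_zero, comp_zero, zero_comp]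

/-- The inclusion of the second summand of a direct sum. -/
noncomputable def directSumInr (X Y : NComplex B N) : Y ⟶ directSum X Y where
  f m := (biprod.inr : _ ⟶ X.X m ⊞ Y.X m)
  comm m := by simp [directSum]

/-- The projection onto the first summand of a direct sum. -/
noncomputable def directSumFst (X Y : NComplex B N) : directSum X Y ⟶ X where
  f m := (biprod.fst : X.X m ⊞ Y.X m ⟶ _)
  comm m := by simp [directSum]

theorem degreewiseSplit_directSum (X Y : NComplex B N) :
    DegreewiseSplit (directSumInr X Y) (directSumFst X Y) := fun m =>
  ⟨(biprod.snd : X.X m ⊞ Y.X m ⟶ _), (biprod.inl : _ ⟶ X.X m ⊞ Y.X m), biprod.inr_snd,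
    biprod.inl_fst, biprod.inr_fst, by rw [add_comm]; exact biprod.total⟩

/-- The morphism into a direct sum with given components. -/
noncomputable def directSumLift {W X Y : NComplex B N} (α : W ⟶ X) (β : W ⟶ Y) :
    W ⟶ directSum X Y where
  f m := (biprod.lift (α.f m) (β.f m) : _ ⟶ X.X m ⊞ Y.X m)
  comm m := by
    refine biprod.hom_ext _ _ ?_ ?_ <;> simp [directSum, α.comm, β.comm]

/-- The morphism out of a direct sum with given components. -/
noncomputable def directSumDesc {X Y Z : NComplex B N} (α : X ⟶ Z) (β : Y ⟶ Z) :
    directSum X Y ⟶ Z where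
  f m := (biprod.desc (α.f m) (β.f m) : X.X m ⊞ Y.X m ⟶ _)
  comm m := by
    refine biprod.hom_ext' _ _ ?_ ?_ <;> simp [directSum, α.comm, β.comm]

variable (X : NComplex B M) (b c : Reindexing M N)

/-- The diagonal morphism of the Mayer–Vietoris sequence. -/
noncomputable def mayerVietorisLift :
    X.reindex (b.inf c) ⟶ directSum (X.reindex b) (X.reindex c) :=
  directSumLift (X.reindexTrans fun _ => min_le_left _ _)
    (X.reindexTrans fun _ => min_le_right _ _)

/-- The difference morphism of the Mayer–Vietoris sequence. -/
noncomputable def mayerVietorisDesc :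
    directSum (X.reindex b) (X.reindex c) ⟶ X.reindex (b.sup c) :=
  directSumDesc (X.reindexTrans fun _ => le_max_left _ _)
    (-X.reindexTrans fun _ => le_max_right _ _)

/-- The Mayer–Vietoris sequence of two reindexings `b` and `c`. In each degree it is split because
the minimum and the maximum of `b m` and `c m` are these two integers in some order. -/
theorem degreewiseSplit_mayerVietoris :
    DegreewiseSplit (mayerVietorisLift X b c) (mayerVietorisDesc X b c) := by
  intro m
  have key : ∀ p q k l : ℤ, (k = p ∧ l = q ∧ p ≤ q) ∨ (k = q ∧ l = p ∧ q ≤ p) →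
      ∃ (ρ : X.X p ⊞ X.X q ⟶ X.X k) (τ : X.X l ⟶ X.X p ⊞ X.X q),
        biprod.lift (X.dd k p) (X.dd k q) ≫ ρ = 𝟙 _ ∧
        τ ≫ biprod.desc (X.dd p l) (-X.dd q l) = 𝟙 _ ∧
        biprod.lift (X.dd k p) (X.dd k q) ≫ biprod.desc (X.dd p l) (-X.dd q l) = 0 ∧
        ρ ≫ biprod.lift (X.dd k p) (X.dd k q) + biprod.desc (X.dd p l) (-X.dd q l) ≫ τ = 𝟙 _ := by
    rintro p q k l (⟨rfl, rfl, h⟩ | ⟨rfl, rfl, h⟩)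
    · refine ⟨biprod.fst, -biprod.inr, ?_, ?_, ?_, ?_⟩
      · simp [dd_self]
      · simp [dd_self]
      · simp [dd_self, biprod.lift_desc]
      · apply biprod.hom_ext' <;> apply biprod.hom_ext <;> simp [dd_self]
    · refine ⟨biprod.snd, biprod.inl, ?_, ?_, ?_, ?_⟩
      · simp [dd_self]
      · simp [dd_self]
      · simp [dd_self, biprod.lift_desc]
      · apply biprod.hom_ext' <;> apply biprod.hom_ext <;> simp [dd_self]
  exact key (b m) (c m) (min (b m) (c m)) (max (b m) (c m)) (by omega)

end MayerVietoris

end NComplex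

/-! ### Every object is a suspension -/

namespace NComplex

attribute [local instance] hasBinaryBiproducts_of_finite_biproducts

variable {B : Type u} [Category.{v} B] [Preadditive B] [HasFiniteBiproducts B] {N : ℕ}

section Ext

variable (X : NComplex B N)

/-- The object `X (m + 1) ⊕ ⋯ ⊕ X (m + N - 1) ⊕ X (m + N)`. -/
noncomputable abbrev shiftExtX (m : ℤ) : B := X.shiftX m ⊞ X.X (m + N)

/-- The differential on `X (m + 1) ⊕ ⋯ ⊕ X (m + N - 1) ⊕ X (m + N)`. It is an extension of the
differential of `X`, translated by `N`, by the one of `ΣX`, and maps `(x₁, …, x_{N-1}, z)` to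
`(x₂, …, x_{N-1}, z - ∑ k, d^{N-k} x_k, d z)`. -/
noncomputable def shiftExtD (m : ℤ) : X.shiftExtX m ⟶ X.shiftExtX (m + 1) :=
  biprod.lift (biprod.fst ≫ X.shiftD m + biprod.snd ≫ X.shiftLast (m + N) (m + 1))
    (biprod.snd ≫ X.dd (m + N) (m + 1 + N))

/-- The `k`-th term of the sequence `(x₁, x₂, …, x_{N-1}, z - ∑ k, d^{N-k} x_k, 0, 0, …)`, pushed
forward to `X j`. -/
noncomputable def shiftExtSeq (m : ℤ) (k : ℕ) (j : ℤ) : X.shiftExtX m ⟶ X.X j :=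
  biprod.fst ≫ X.shiftSeq m k j + biprod.snd ≫ (if k + 1 = N then X.dd (m + N) j else 0)

theorem shiftExtD_seq (hN : 2 ≤ N) (m : ℤ) (k : ℕ) {j : ℤ} (h : m + 1 + 1 + k ≤ j) :
    X.shiftExtD m ≫ X.shiftExtSeq (m + 1) k j = X.shiftExtSeq m (k + 1) j := by
  rw [shiftExtD, shiftExtSeq, shiftExtSeq, Preadditive.comp_add, biprod.lift_fst_assoc,
    biprod.lift_snd_assoc, Preadditive.add_comp, Category.assoc, Category.assoc, Category.assoc,
    shiftD_seq _ _ _ h, X.shiftLast_seq hN (by omega) _ h, add_assoc, ← Preadditive.comp_add]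
  congr 2
  by_cases h1 : k + 2 = N
  · rw [if_pos h1, if_neg (by omega), if_pos (by omega), comp_zero, add_zero]
  · rw [if_neg h1, if_neg (show ¬ k + 1 + 1 = N by omega)]
    by_cases h2 : k + 1 = N
    · rw [if_pos h2, if_pos h2, X.dd_comp (by omega) (by omega), neg_add_cancel]
    · rw [if_neg h2, if_neg h2, comp_zero, add_zero]

theorem shiftExtD_iter_seq (hN : 2 ≤ N) (m : ℤ) (n k : ℕ) {j : ℤ} (h : m + n + 1 + k ≤ j) :
    dComp X.shiftExtX X.shiftExtD m (m + n) ≫ X.shiftExtSeq (m + n) k j =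
      X.shiftExtSeq m (n + k) j := by
  induction n generalizing k with
  | zero =>
    have e : m + ((0 : ℕ) : ℤ) = m := by simp
    rw [e, dComp_self, Category.id_comp, Nat.zero_add]
  | succ n ih =>
    have e : m + ((n + 1 : ℕ) : ℤ) = (m + n) + 1 := by push_cast; ring
    rw [e] at h ⊢
    rw [← dComp_comp _ _ (show m ≤ m + n by omega) (show m + n ≤ m + n + 1 by omega), dComp_succ,
      Category.assoc, shiftExtD_seq _ hN _ _ h, ih _ (by push_cast; omega)]
    congr 1
    omega

theorem shiftExt_hom_ext (hN : 1 ≤ N) {T : B} {m : ℤ} {g g' : T ⟶ X.shiftExtX m}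
    (h : ∀ (k : ℕ) (j : ℤ), k < N → m + 1 + k = j →
      g ≫ X.shiftExtSeq m k j = g' ≫ X.shiftExtSeq m k j) : g = g' := by
  have h1 : g ≫ biprod.fst = g' ≫ biprod.fst := by
    refine X.shift_ext fun k hk => ?_
    have := h k _ (by omega) rfl
    rwa [shiftExtSeq, if_neg (by omega), comp_zero, add_zero, ← Category.assoc, ← Category.assoc,
      shiftSeq_eq_proj _ _ _ hk] at this
  refine biprod.hom_ext _ _ h1 ?_
  have := h (N - 1) (m + N) (by omega) (by omega)
  rwa [shiftExtSeq, if_pos (by omega), dd_self, Category.comp_id, Preadditive.comp_add,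
    Preadditive.comp_add, ← Category.assoc, ← Category.assoc, h1, add_right_inj] at this

/-- A contractible extension of `X`, translated by `N`, by `ΣX`. -/
noncomputable abbrev shiftExt (hN : 2 ≤ N) : NComplex B N where
  X := X.shiftExtX
  d := X.shiftExtD
  dComp_eq_zero m := by
    refine X.shiftExt_hom_ext (by omega) fun k j hk hj => ?_
    rw [zero_comp, shiftExtD_iter_seq _ hN _ _ _ (by omega), shiftExtSeq, shiftSeq,
      if_neg (by omega), if_neg (by omega), if_neg (by omega), comp_zero, comp_zero, add_zero]

theorem shiftExt_dd_seq (hN : 2 ≤ N) {m m' : ℤ} (hm : m ≤ m') (k k' : ℕ) (hk : m' + k = m + k')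
    {j : ℤ} (h : m' + 1 + k ≤ j) :
    (X.shiftExt hN).dd m m' ≫ X.shiftExtSeq m' k j = X.shiftExtSeq m k' j := by
  obtain ⟨n, rfl⟩ := Int.le.dest hm
  obtain rfl : k' = n + k := by omega
  exact X.shiftExtD_iter_seq hN m n k h

theorem nullHomotopic_id_shiftExt (hN : 2 ≤ N) : NullHomotopic (𝟙 (X.shiftExt hN)) := by
  have key : ∀ (i : ℤ) (k : ℕ) (j : ℤ), k < N → i - N + 1 + 1 + k = j →
      (X.dd (i + 1) (i - N + 1 + N) ≫
        (biprod.inr : _ ⟶ X.shiftX (i - N + 1) ⊞ X.X (i - N + 1 + N))) ≫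
          X.shiftExtSeq (i - N + 1) k j = if k + 1 = N then X.dd (i + 1) j else 0 := by
    intro i k j hk hj
    rw [shiftExtSeq, Preadditive.comp_add, Category.assoc, biprod.inr_fst_assoc, zero_comp,
      comp_zero, zero_add, Category.assoc, biprod.inr_snd_assoc]
    split_ifs with h
    · rw [X.dd_comp (by omega) (by omega)]
    · rw [comp_zero]
  refine nullHomotopic_id_of_coordinates _ (fun i => X.X (i + 1))
    (fun i => X.shiftExtSeq i 0 (i + 1)) (fun i => X.dd (i + 1) (i - N + 1 + N) ≫
        (biprod.inr : _ ⟶ X.shiftX (i - N + 1) ⊞ X.X (i - N + 1 + N))) ?_ ?_ ?_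
  · intro i
    rw [shiftExt_dd_seq _ _ (by omega) _ (N - 1) (by omega) (by omega),
      key _ _ _ (by omega) (by omega), if_pos (by omega), dd_self]
  · intro i j h h'
    rw [shiftExt_dd_seq _ _ (by omega) _ (j - (i - N + 1)).toNat (by omega) (by omega),
      key _ _ _ (by omega) (by omega), if_neg (by omega)]
  · intro i u hu
    refine X.shiftExt_hom_ext (by omega) fun k j hk hj => ?_
    have := hu k hk
    rwa [shiftExt_dd_seq _ _ (by omega) _ k (by omega) (by push_cast; omega),
      show i + (k : ℤ) + 1 = j by omega, ← zero_comp (X := X.shiftExtX i)] at this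

/-- The inclusion of `ΣX`. -/
noncomputable def shiftExtInl (hN : 2 ≤ N) : X.shift ⟶ X.shiftExt hN where
  f m := (biprod.inl : _ ⟶ X.shiftX m ⊞ X.X (m + N))
  comm m := by
    refine biprod.hom_ext _ _ ?_ ?_ <;> simp [shiftExtD]

/-- The projection onto the translate of `X`. -/
noncomputable def shiftExtSnd (hN : 2 ≤ N) :
    X.shiftExt hN ⟶ X.reindex (Reindexing.translation N N) where
  f m := (biprod.snd : X.shiftX m ⊞ X.X (m + N) ⟶ _)
  comm _ := biprod.lift_snd _ _

theorem degreewiseSplit_shiftExt (hN : 2 ≤ N) :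
    DegreewiseSplit (X.shiftExtInl hN) (X.shiftExtSnd hN) := fun i =>
  ⟨(biprod.fst : X.shiftX i ⊞ X.X (i + N) ⟶ _), (biprod.inr : _ ⟶ X.shiftX i ⊞ X.X (i + N)),
    biprod.inl_fst, biprod.inr_snd, biprod.inl_snd, biprod.total⟩

end Ext

end NComplex

namespace KN

variable {B : Type u} [Category.{v} B] [Preadditive B] [HasFiniteBiproducts B] {M N : ℕ}

/-- Every object of the homotopy category is a suspension: if `Y` is the translate of `X` by `-N`,
then `Σ(ΣY) ≅ X`, because of the degreewise split exact sequence from `ΣY` to `X` with middle term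
the contractible complex `Y.shiftExt`. -/
theorem exists_susp_iso (hN : 1 ≤ N) (X : NComplex B N) :
    ∃ Y : NComplex B N, Nonempty ((susp B N).obj ((quotient B N).obj Y) ≅
      (quotient B N).obj X) := by
  obtain rfl | hN' := hN.eq_or_lt
  · exact ⟨X, nonempty_iso_of_nullHomotopic_id (NComplex.nullHomotopic_of_one (𝟙 X.shift))
      (NComplex.nullHomotopic_of_one (𝟙 X))⟩
  · let Y := X.reindex (Reindexing.translation N (-N))
    obtain ⟨e⟩ := nonempty_susp_iso hN (Y.degreewiseSplit_shiftExt hN')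
      (Y.nullHomotopic_id_shiftExt hN')
    obtain ⟨e'⟩ := X.nonempty_reindex_iso_of_le
      ((Reindexing.translation N (-N)).comp (Reindexing.translation N N))
      (fun m => by simp [Reindexing.comp, Reindexing.translation])
      (fun m => by
        have e : (Reindexing.translation N (-N)).comp (Reindexing.translation N N) m = m := by
          simp [Reindexing.comp, Reindexing.translation]
        rw [e, NComplex.dd_self]
        infer_instance)
    exact ⟨Y.shift, ⟨e ≪≫ (quotient B N).mapIso (X.reindexComp _ _ ≪≫ e')⟩⟩

/-- Reindexing as a functor on homotopy categories. -/
def reindexFunctor (b : Reindexing M N)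
    (hb : ∀ m, b (m + 1) = b m ∨ b (m + 1) = b m + 1) (hb' : ∀ m, b (m + N) = b m + M) :
    KN B M ⥤ KN B N :=
  CategoryTheory.Quotient.lift _ (NComplex.reindexFunctor B b ⋙ quotient B N)
    (fun _ _ _ _ h => quotient_map_eq (NComplex.NullHomotopic.reindex b hb hb' h))

/-- Reindexing commutes with the suspension: it maps the sequence `X ⟶ C(𝟙 X) ⟶ ΣX` to a
degreewise split exact sequence with contractible middle term. -/
theorem nonempty_susp_reindex_iso (hN : 1 ≤ N) (hM : 1 ≤ M) (b : Reindexing M N)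
    (hb : ∀ m, b (m + 1) = b m ∨ b (m + 1) = b m + 1) (hb' : ∀ m, b (m + N) = b m + M)
    (X : NComplex B M) :
    Nonempty ((susp B N).obj ((quotient B N).obj (X.reindex b)) ≅
      (quotient B N).obj (X.shift.reindex b)) := by
  refine nonempty_susp_iso hN
    ((NComplex.degreewiseSplit_coneInr_coneSnd (𝟙 X)).reindex b) ?_
  have := (X.nullHomotopic_id_cone_id hM).reindex b hb hb'
  rwa [CategoryTheory.Functor.map_id] at this

end KN

/-! ### Complexes with identities -/

namespace Reindexing

theorem ediv_eq_of_add {N x t p : ℤ} (hx : x = N * t + p) (h : 0 ≤ p) (h' : p < N) :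
    x / N = t :=
  ((Int.ediv_emod_unique (show 0 < N by omega)).2 ⟨by rw [hx]; ring, h, h'⟩).1

theorem exists_eq_add_mul {N : ℤ} (hN : 0 < N) (s m : ℤ) :
    ∃ t p, m = s + N * t + p ∧ 0 ≤ p ∧ p < N :=
  ⟨(m - s) / N, (m - s) % N, by have := Int.mul_ediv_add_emod (m - s) N; omega,
    Int.emod_nonneg _ hN.ne', Int.emod_lt_of_pos _ hN⟩

theorem exists_eq_of_modEq {N i s : ℤ} (h : i ≡ s [ZMOD N]) : ∃ t, i = s + N * t := by
  obtain ⟨t, ht⟩ := Int.modEq_iff_dvd.1 h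
  exact ⟨-t, by rw [mul_neg]; omega⟩

section Step

variable (N : ℕ) (s : ℤ) (r : ℕ)

/-- The map `j ↦ s + N j`, as a reindexing from `N`-complexes to `1`-complexes. -/
def multiples : Reindexing N 1 where
  toFun j := s + N * j
  monotone i j h := by
    have := mul_le_mul_of_nonneg_left h (Int.natCast_nonneg N)
    change s + N * i ≤ s + N * j
    omega
  add_le m := by push_cast; rw [mul_add]; omega

theorem floor_eq {m t p : ℤ} (h : m + N = s + N * t + r + 1 + p) (hp : 0 ≤ p) (hp' : p < N) :
    (m - s + (N - 1 - r)) / N = t :=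
  ediv_eq_of_add (by omega) hp hp'

/-- The monotone map sending the interval `s + N j + r + 1 - N, …, s + N j + r` to `j`. -/
def floor (hr : r < N) : Reindexing 1 N where
  toFun m := (m - s + (N - 1 - r)) / N
  monotone i j h := Int.ediv_le_ediv (by omega) (by omega)
  add_le m := by
    rw [show m + N - s + (N - 1 - r : ℤ) = m - s + (N - 1 - r) + N by ring,
      Int.add_ediv_of_dvd_right (dvd_refl _), Int.ediv_self (by omega)]
    simp

/-- The monotone map whose value on `s + N j + r + 1 - N, …, s + N j + r` is `s + N j`. -/
def step (hr : r < N) : Reindexing N N := (multiples N s).comp (floor N s r hr)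

theorem step_eq (hr : r < N) {m i : ℤ} (hi : i ≡ s [ZMOD N]) (h : i + r + 1 ≤ m + N)
    (h' : m ≤ i + r) :
    step N s r hr m = i := by
  obtain ⟨t, rfl⟩ := exists_eq_of_modEq hi
  change s + N * ((m - s + (N - 1 - r)) / N) = s + N * t
  rw [floor_eq N s r (t := t) (p := m + N - (s + N * t + r + 1)) (by omega) (by omega) (by omega)]

/-- The value `i` of `step` at `m` is the unique `i ≡ s` modulo `N` with
`i + r + 1 - N ≤ m ≤ i + r`. -/
theorem step_spec (hr : r < N) (m : ℤ) : step N s r hr m ≡ s [ZMOD N] ∧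
    step N s r hr m + r + 1 ≤ m + N ∧ m ≤ step N s r hr m + r := by
  obtain ⟨t, p, h, hp, hp'⟩ := exists_eq_add_mul (show (0 : ℤ) < N by omega) (s + r + 1) (m + N)
  have hi : s + N * t ≡ s [ZMOD N] := Int.modEq_iff_dvd.2 ⟨-t, by ring⟩
  rw [step_eq N s r hr hi (by omega) (by omega)]
  exact ⟨hi, by omega, by omega⟩

theorem floor_succ (hr : r < N) (m : ℤ) :
    floor N s r hr (m + 1) = floor N s r hr m ∨ floor N s r hr (m + 1) = floor N s r hr m + 1 := by
  obtain ⟨t, p, h, hp, hp'⟩ := exists_eq_add_mul (show (0 : ℤ) < N by omega) (s + r + 1) (m + N)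
  change (m + 1 - s + (N - 1 - r : ℤ)) / N = (m - s + (N - 1 - r)) / N ∨
    (m + 1 - s + (N - 1 - r : ℤ)) / N = (m - s + (N - 1 - r)) / N + 1
  rw [floor_eq N s r (m := m) (t := t) (p := p) (by omega) hp hp']
  by_cases h1 : p + 1 < N
  · left
    exact floor_eq N s r (p := p + 1) (by omega) (by omega) h1
  · right
    exact floor_eq N s r (p := 0) (by rw [mul_add]; omega) le_rfl (by omega)

theorem floor_add (hr : r < N) (m : ℤ) : floor N s r hr (m + N) = floor N s r hr m + (1 : ℕ) := by
  change (m + N - s + (N - 1 - r : ℤ)) / N = (m - s + (N - 1 - r)) / N + _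
  rw [show m + N - s + (N - 1 - r : ℤ) = m - s + (N - 1 - r) + N by ring,
    Int.add_ediv_of_dvd_right (dvd_refl _), Int.ediv_self (by omega)]
  simp

end Step

section Collapse

variable {M N : ℕ} (s : ℤ) (r : ℕ)

theorem collapse_eq {m t p : ℤ} (h : m = s + N * t + p) (hp : 0 ≤ p) (hp' : p < N) :
    (M : ℤ) * ((m - s) / N) + max 0 ((m - s) % N - r) = M * t + max 0 (p - r) := by
  have h1 : (m - s) / N = t := ediv_eq_of_add (p := p) (by omega) hp hp'
  have h2 := Int.mul_ediv_add_emod (m - s) N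
  rw [h1] at h2 ⊢
  rw [show (m - s) % N = p by omega]

theorem expand_eq {j t c : ℤ} (h : j = M * t + c) (hc : 0 ≤ c) (hc' : c < M) :
    s + N * (j / M) + (if j % M = 0 then 0 else r + j % M) =
      s + N * t + (if c = 0 then 0 else r + c) := by
  have h1 : j / M = t := ediv_eq_of_add h hc hc'
  have h2 := Int.mul_ediv_add_emod j M
  rw [h1] at h2 ⊢
  rw [show j % M = c by omega]

theorem collapse_succ (hM : 1 ≤ M) (h : M + r = N) (m : ℤ) :
    (M : ℤ) * ((m + 1 - s) / N) + max 0 ((m + 1 - s) % N - r) =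
        M * ((m - s) / N) + max 0 ((m - s) % N - r) ∨
      (M : ℤ) * ((m + 1 - s) / N) + max 0 ((m + 1 - s) % N - r) =
        M * ((m - s) / N) + max 0 ((m - s) % N - r) + 1 := by
  obtain ⟨t, p, e, hp, hp'⟩ := exists_eq_add_mul (show (0 : ℤ) < N by omega) s m
  rw [collapse_eq s r e hp hp']
  by_cases h1 : p + 1 < N
  · rw [collapse_eq s r (t := t) (p := p + 1) (by omega) (by omega) h1]
    omega
  · rw [collapse_eq s r (t := t + 1) (p := 0) (by rw [mul_add]; omega) le_rfl (by omega), mul_add]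
    omega

theorem collapse_add (hM : 1 ≤ M) (h : M + r = N) (m : ℤ) :
    (M : ℤ) * ((m + N - s) / N) + max 0 ((m + N - s) % N - r) =
      M * ((m - s) / N) + max 0 ((m - s) % N - r) + M := by
  obtain ⟨t, p, e, hp, hp'⟩ := exists_eq_add_mul (show (0 : ℤ) < N by omega) s m
  rw [collapse_eq s r e hp hp',
    collapse_eq s r (t := t + 1) (p := p) (by rw [mul_add]; omega) hp hp', mul_add]
  omega

/-- The monotone surjection `ℤ → ℤ` whose fibres are the sets `{s + N t, …, s + N t + r}` and the
singletons outside them. -/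
def collapse (hM : 1 ≤ M) (h : M + r = N) : Reindexing M N where
  toFun m := M * ((m - s) / N) + max 0 ((m - s) % N - r)
  monotone := monotone_int_of_le_succ fun m => by
    have := collapse_succ s r hM h m
    omega
  add_le m := (collapse_add s r hM h m).ge

/-- The section of `collapse` with values the least elements of the fibres. -/
def expand (hM : 1 ≤ M) (h : M + r = N) : Reindexing N M where
  toFun j := s + N * (j / M) + (if j % M = 0 then 0 else r + j % M)
  monotone := monotone_int_of_le_succ fun j => by
    obtain ⟨t, c, e, hc, hc'⟩ := exists_eq_add_mul (show (0 : ℤ) < M by omega) 0 j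
    rw [expand_eq s r (t := t) (c := c) (by omega) hc hc']
    by_cases h1 : c + 1 < M
    · rw [expand_eq s r (t := t) (c := c + 1) (by omega) (by omega) h1]
      split_ifs <;> omega
    · rw [expand_eq s r (t := t + 1) (c := 0) (by rw [mul_add]; omega) le_rfl (by omega), mul_add]
      split_ifs <;> omega
  add_le j := by
    obtain ⟨t, c, e, hc, hc'⟩ := exists_eq_add_mul (show (0 : ℤ) < M by omega) 0 j
    rw [expand_eq s r (t := t) (c := c) (by omega) hc hc',
      expand_eq s r (t := t + 1) (c := c) (by rw [mul_add]; omega) hc hc', mul_add]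
    split_ifs <;> omega

theorem collapse_eq_collapse (hM : 1 ≤ M) (h : M + r = N) {i : ℤ} (hi : i ≡ s [ZMOD N]) {k : ℕ}
    (hk : k < r) : collapse s r hM h (i + k) = collapse s r hM h (i + k + 1) := by
  obtain ⟨t, rfl⟩ := exists_eq_of_modEq hi
  change (M : ℤ) * ((s + N * t + k - s) / N) + max 0 ((s + N * t + k - s) % N - r) =
    M * ((s + N * t + k + 1 - s) / N) + max 0 ((s + N * t + k + 1 - s) % N - r)
  rw [collapse_eq s r (t := t) (p := k) rfl (by omega) (by omega),
    collapse_eq s r (t := t) (p := k + 1) (by ring) (by omega) (by omega)]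
  omega

/-- The composite `expand ∘ collapse` maps each fibre `{i, …, i + r}` of `collapse` to `i`, and
fixes the other integers. -/
theorem expand_collapse (hM : 1 ≤ M) (h : M + r = N) (m : ℤ) :
    expand s r hM h (collapse s r hM h m) = m ∨ ∃ i : ℤ, ∃ k : ℕ, i ≡ s [ZMOD N] ∧ k ≤ r ∧
      m = i + k ∧ expand s r hM h (collapse s r hM h m) = i := by
  obtain ⟨t, p, e, hp, hp'⟩ := exists_eq_add_mul (show (0 : ℤ) < N by omega) s m
  have e1 : expand s r hM h (collapse s r hM h m) =
      s + N * t + (if max 0 (p - r) = 0 then 0 else r + max 0 (p - r)) := by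
    change s + N * (((M : ℤ) * ((m - s) / N) + max 0 ((m - s) % N - r)) / M) +
      (if ((M : ℤ) * ((m - s) / N) + max 0 ((m - s) % N - r)) % M = 0 then 0
        else r + ((M : ℤ) * ((m - s) / N) + max 0 ((m - s) % N - r)) % M) = _
    rw [collapse_eq s r e hp hp']
    exact expand_eq s r rfl (by omega) (by omega)
  rw [e1]
  by_cases h1 : p ≤ r
  · right
    refine ⟨s + N * t, p.toNat, Int.modEq_iff_dvd.2 ⟨-t, by ring⟩, by omega, by omega, ?_⟩
    rw [if_pos (by omega), add_zero]
  · left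
    rw [if_neg (by omega)]
    omega

end Collapse

end Reindexing

namespace NComplex

section Basic

variable {B : Type u} [Category.{v} B] [HasZeroMorphisms B] {M N : ℕ}

theorem dd_eq_eqToHom (X : NComplex B N) {i j : ℤ} (h : i = j) :
    X.dd i j = eqToHom (congrArg X.X h) := by
  subst h
  exact X.dd_self i

end Basic

section Preadd

variable {B : Type u} [Category.{v} B] [Preadditive B] {M N : ℕ}

theorem hasIdentities_reindex (X : NComplex B M) (b : Reindexing M N) {s : ℤ} {r : ℕ}
    (h : ∀ i : ℤ, i ≡ s [ZMOD N] → ∀ k : ℕ, k < r → b (i + k) = b (i + k + 1)) :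
    HasIdentities s r (X.reindex b) := fun i hi k hk =>
  ⟨congrArg X.X (h i hi k hk), X.dd_eq_eqToHom (h i hi k hk)⟩

theorem HasIdentities.isIso_dd {X : NComplex B N} {s : ℤ} {r : ℕ} (h : HasIdentities s r X)
    {i : ℤ} (hi : i ≡ s [ZMOD N]) {k l : ℕ} (hkl : k ≤ l) (hl : l ≤ r) :
    IsIso (X.dd (i + k) (i + l)) := by
  induction l, hkl using Nat.le_induction with
  | base =>
    rw [dd_self]
    infer_instance
  | succ l hkl ih =>
    have := ih (by omega)
    obtain ⟨e, he⟩ := h i hi l (by omega)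
    have : IsIso (X.d (i + l)) := by rw [he]; infer_instance
    rw [show i + ((l + 1 : ℕ) : ℤ) = i + l + 1 by push_cast; ring,
      ← X.dd_comp (show i + (k : ℤ) ≤ i + l by omega) (by omega), dd_succ]
    infer_instance

/-- A complex with identities is, up to isomorphism, reindexed from a complex of shorter length,
obtained by leaving out the identities. -/
theorem HasIdentities.nonempty_reindex_collapse_iso {X : NComplex B N} {s : ℤ} {r : ℕ}
    (h : HasIdentities s r X) (hM : 1 ≤ M) (hMN : M + r = N) :
    Nonempty ((X.reindex (.expand s r hM hMN)).reindex (.collapse s r hM hMN) ≅ X) := by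
  have key := Reindexing.expand_collapse s r hM hMN
  obtain ⟨e⟩ := X.nonempty_reindex_iso_of_le
    ((Reindexing.expand s r hM hMN).comp (.collapse s r hM hMN))
    (fun m => by
      change Reindexing.expand s r hM hMN (Reindexing.collapse s r hM hMN m) ≤ m
      obtain e | ⟨i, k, _, _, e1, e2⟩ := key m <;> omega)
    (fun m => by
      change IsIso (X.dd (Reindexing.expand s r hM hMN (Reindexing.collapse s r hM hMN m)) m)
      obtain e | ⟨i, k, hi, hk, rfl, e⟩ := key m
      · rw [e, dd_self]
        infer_instance
      · rw [e]
        have := h.isIso_dd hi (Nat.zero_le k) hk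
        rwa [Nat.cast_zero, add_zero] at this)
  exact ⟨X.reindexComp _ _ ≪≫ e⟩

section Step

variable {s : ℤ} {r : ℕ} (hr : r < N)

/-- A complex with identities in the degrees of `F_s^r` is not changed by reindexing along the
minimum of the identity and `step`. -/
theorem HasIdentities.isIso_dd_inf {X : NComplex B N} (h : HasIdentities s r X) (m : ℤ) :
    IsIso (X.dd ((Reindexing.id N).inf (.step N s r hr) m) m) := by
  change IsIso (X.dd (min m (Reindexing.step N s r hr m)) m)
  obtain ⟨h1, h2, h3⟩ := Reindexing.step_spec N s r hr m
  rcases le_total m (Reindexing.step N s r hr m) with h4 | h4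
  · rw [min_eq_left h4, dd_self]
    infer_instance
  · rw [min_eq_right h4]
    have := h.isIso_dd h1 (Nat.zero_le _)
      (show (m - Reindexing.step N s r hr m).toNat ≤ r by omega)
    rwa [Int.toNat_of_nonneg (by omega), add_sub_cancel, Nat.cast_zero, add_zero] at this

/-- A complex with identities in the degrees of `F_{r+s+1}^{N-r-1}` is not changed by reindexing
along the maximum of the identity and `step`. -/
theorem HasIdentities.isIso_dd_sup {X : NComplex B N}
    (h : HasIdentities (r + s + 1) (N - r - 1) X) (m : ℤ) :
    IsIso (X.dd m ((Reindexing.id N).sup (.step N s r hr) m)) := by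
  change IsIso (X.dd m (max m (Reindexing.step N s r hr m)))
  obtain ⟨h1, h2, h3⟩ := Reindexing.step_spec N s r hr m
  rcases le_total (Reindexing.step N s r hr m) m with h4 | h4
  · rw [max_eq_left h4, dd_self]
    infer_instance
  · rw [max_eq_right h4]
    obtain ⟨t, ht⟩ := Reindexing.exists_eq_of_modEq h1
    have hi : Reindexing.step N s r hr m - ((N - r - 1 : ℕ) : ℤ) ≡ r + s + 1 [ZMOD N] :=
      Int.modEq_iff_dvd.2 ⟨1 - t, by rw [mul_sub]; omega⟩
    have := h.isIso_dd hi (k := (m - (Reindexing.step N s r hr m - (N - r - 1 : ℕ))).toNat)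
      (by omega) le_rfl
    rwa [Int.toNat_of_nonneg (by omega), add_sub_cancel, sub_add_cancel] at this

variable (s) in
theorem hasIdentities_reindex_inf (X : NComplex B N) :
    HasIdentities s r (X.reindex ((Reindexing.id N).inf (.step N s r hr))) := by
  refine hasIdentities_reindex _ _ fun i hi k hk => ?_
  change min (i + k) (Reindexing.step N s r hr (i + k)) =
    min (i + k + 1) (Reindexing.step N s r hr (i + k + 1))
  rw [Reindexing.step_eq N s r hr hi (by omega) (by omega),
    Reindexing.step_eq N s r hr hi (by omega) (by omega)]
  omega

variable (s) in
theorem hasIdentities_reindex_sup (X : NComplex B N) :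
    HasIdentities (r + s + 1) (N - r - 1)
      (X.reindex ((Reindexing.id N).sup (.step N s r hr))) := by
  refine hasIdentities_reindex _ _ fun i hi k hk => ?_
  change max (i + k) (Reindexing.step N s r hr (i + k)) =
    max (i + k + 1) (Reindexing.step N s r hr (i + k + 1))
  obtain ⟨t, ht⟩ := Reindexing.exists_eq_of_modEq hi
  have hi' : i - r - 1 + N ≡ s [ZMOD N] :=
    Int.modEq_iff_dvd.2 ⟨-t - 1, by rw [mul_sub, mul_neg]; omega⟩
  rw [Reindexing.step_eq N s r hr hi' (by omega) (by omega),
    Reindexing.step_eq N s r hr hi' (by omega) (by omega)]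
  omega

variable (s) in
/-- The complex `X.reindex step` is contractible, since it is reindexed from a `1`-complex. -/
theorem nullHomotopic_id_reindex_step (X : NComplex B N) :
    NullHomotopic (𝟙 (X.reindex (.step N s r hr))) := by
  have h := NullHomotopic.reindex _ (Reindexing.floor_succ N s r hr)
    (Reindexing.floor_add N s r hr) (nullHomotopic_of_one (𝟙 (X.reindex (.multiples N s))))
  rw [CategoryTheory.Functor.map_id] at h
  have e := X.reindexComp (.multiples N s) (.floor N s r hr)
  have := NullHomotopic.comp_left e.inv (h.comp_right e.hom)
  change NullHomotopic (e.inv ≫ 𝟙 _ ≫ e.hom) at this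
  rwa [Category.id_comp, e.inv_hom_id] at this

/-- A morphism `φ : X ⟶ Y` is null-homotopic if `X` has identities at `s, …, s + r - 1` and `Y` has
identities at `s + r + 1, …, s + N - 1`. With `b := step`, one may replace `X` by its reindexing
along `min (id, b)` and `Y` by its reindexing along `max (id, b)`; the morphism then factors through
the contractible complex `X.reindex b`. -/
theorem HasIdentities.nullHomotopic (hr : r < N) {X Y : NComplex B N} (hX : HasIdentities s r X)
    (hY : HasIdentities (r + s + 1) (N - r - 1) Y) (φ : X ⟶ Y) : NullHomotopic φ := by
  let b := Reindexing.step N s r hr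
  let α : X.reindex ((Reindexing.id N).inf b) ⟶ X.reindex (Reindexing.id N) :=
    X.reindexTrans fun _ => min_le_left _ _
  let γ : Y.reindex (Reindexing.id N) ⟶ Y.reindex ((Reindexing.id N).sup b) :=
    Y.reindexTrans fun _ => le_max_left _ _
  let α' : X.reindex ((Reindexing.id N).inf b) ⟶ X.reindex b :=
    X.reindexTrans fun _ => min_le_right _ _
  let γ' : Y.reindex b ⟶ Y.reindex ((Reindexing.id N).sup b) :=
    Y.reindexTrans fun _ => le_max_right _ _
  have : IsIso α := isIso_of_isIso_f α (hX.isIso_dd_inf hr)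
  have : IsIso γ := isIso_of_isIso_f γ (hY.isIso_dd_sup hr)
  let ψ := reindexMap φ (Reindexing.id N)
  have e : α ≫ ψ ≫ γ = α' ≫ reindexMap φ b ≫ γ' := hom_ext fun m =>
    dd_comp_f_comp_dd φ (min_le_left m (b m)) (min_le_right m (b m)) (le_max_left m (b m))
      (le_max_right m (b m))
  have h1 : NullHomotopic (α ≫ ψ ≫ γ) := by
    rw [e, ← Category.id_comp (reindexMap φ b ≫ γ')]
    exact NullHomotopic.comp_left _ ((X.nullHomotopic_id_reindex_step s hr).comp_right _)
  have h2 : NullHomotopic (inv α ≫ (α ≫ ψ ≫ γ) ≫ inv γ) :=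
    NullHomotopic.comp_left _ (h1.comp_right _)
  have h3 : NullHomotopic ψ := by simpa using h2
  convert NullHomotopic.comp_left X.reindexId.inv (h3.comp_right Y.reindexId.hom)
  exact hom_ext fun m => ((Category.id_comp _).trans (Category.comp_id _)).symm

end Step

end Preadd

end NComplex

/-! ### The stable t-structure -/

namespace KN

variable {B : Type u} [Category.{v} B] [Preadditive B] {N : ℕ}

theorem F_of_iso {s : ℤ} {r : ℕ} {X : NComplex B N} (hX : NComplex.HasIdentities s r X)
    {Y : KN B N} (e : (quotient B N).obj X ≅ Y) : F B N s r Y := ⟨X, hX, ⟨e⟩⟩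

theorem F_hom_eq_zero {s : ℤ} {r : ℕ} (hr : r < N) {X Y : KN B N} (hX : F B N s r X)
    (hY : F B N (r + s + 1) (N - r - 1) Y) (f : X ⟶ Y) : f = 0 := by
  obtain ⟨X', hX', ⟨e⟩⟩ := hX
  obtain ⟨Y', hY', ⟨e'⟩⟩ := hY
  obtain ⟨φ, hφ⟩ := (quotient B N).map_surjective (e.hom ≫ f ≫ e'.inv)
  rw [quotient_map_eq_zero (hX'.nullHomotopic hr hY' φ)] at hφ
  simpa using congrArg (fun g => e.inv ≫ g ≫ e'.hom) hφ.symm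

variable [HasFiniteBiproducts B]

/-- The subcategory `F_s^r` is stable under the suspension and its inverse, being the essential
image of the homotopy category of `(N - r)`-complexes under a functor that commutes with `Σ`. -/
theorem F_map_susp (s : ℤ) {r : ℕ} (hr : r < N) : (F B N s r).map (susp B N) = F B N s r := by
  obtain ⟨M, hM⟩ : ∃ M, M + r = N := ⟨N - r, by omega⟩
  have hM' : 1 ≤ M := by omega
  let b := Reindexing.collapse s r hM' hM
  have hb := Reindexing.collapse_succ s r hM' hM
  have hb' := Reindexing.collapse_add s r hM' hM
  have hF : ∀ X : NComplex B M, NComplex.HasIdentities s r (X.reindex b) := fun X =>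
    X.hasIdentities_reindex b fun i hi k hk => Reindexing.collapse_eq_collapse s r hM' hM hi hk
  ext Z
  constructor
  · rintro ⟨Y, ⟨X, hX, ⟨e⟩⟩, ⟨e'⟩⟩
    obtain ⟨i⟩ := hX.nonempty_reindex_collapse_iso hM' hM
    obtain ⟨j⟩ := nonempty_susp_reindex_iso (by omega) hM' b hb hb'
      (X.reindex (.expand s r hM' hM))
    exact F_of_iso (hF _)
      (j.symm ≪≫ (susp B N).mapIso ((quotient B N).mapIso i ≪≫ e) ≪≫ e')
  · rintro ⟨X, hX, ⟨e⟩⟩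
    obtain ⟨i⟩ := hX.nonempty_reindex_collapse_iso hM' hM
    obtain ⟨Y, ⟨j⟩⟩ := exists_susp_iso hM' (X.reindex (.expand s r hM' hM))
    obtain ⟨k⟩ := nonempty_susp_reindex_iso (by omega) hM' b hb hb' Y
    exact ⟨_, F_of_iso (hF Y) (Iso.refl _),
      ⟨k ≪≫ (reindexFunctor b hb hb').mapIso j ≪≫ (quotient B N).mapIso i ≪≫ e⟩⟩

theorem F_exists_triangle (s : ℤ) {r : ℕ} (hr : r < N) (X : KN B N) :
    ∃ (X₁ X₂ : KN B N) (f : X₁ ⟶ X) (g : X ⟶ X₂) (h : X₂ ⟶ (susp B N).obj X₁),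
      F B N s r X₁ ∧ F B N (r + s + 1) (N - r - 1) X₂ ∧ IsDistTriangle f g h := by
  obtain ⟨X⟩ := X
  have := isIso_quotient_map
    (NComplex.degreewiseSplit_directSum (X.reindex (.id N)) (X.reindex (.step N s r hr)))
    (X.nullHomotopic_id_reindex_step s hr)
  obtain ⟨f, g, h, H⟩ := exists_isDistTriangle (by omega)
    (X.degreewiseSplit_mayerVietoris (.id N) (.step N s r hr))
    ((quotient B N).mapIso X.reindexId.symm ≪≫ (asIso ((quotient B N).map
      (NComplex.directSumFst (X.reindex (.id N)) (X.reindex (.step N s r hr))))).symm)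
  exact ⟨_, _, f, g, h, F_of_iso (X.hasIdentities_reindex_inf s hr) (Iso.refl _),
    F_of_iso (X.hasIdentities_reindex_sup s hr) (Iso.refl _), H⟩

end KN

theorem mainTheorem4 (B : Type u) [Category.{v} B] [Preadditive B] [HasFiniteBiproducts B]
    (N : ℕ) (hN : 2 ≤ N) (s : ℤ) (r : ℕ) (hr : 1 ≤ r) (hrN : r < N) :
    KN.IsStableTStructure (KN.F B N s r) (KN.F B N (r + s + 1) (N - r - 1)) where
  susp_left := KN.F_map_susp s hrN
  susp_right := KN.F_map_susp _ (by omega)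
  hom_eq_zero _ _ hX hY f := KN.F_hom_eq_zero hrN hX hY f
  exists_triangle X := KN.F_exists_triangle s hrN X
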